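/- Let $k\ge 1$ be an integer and let $X$ be a real-valued Lévy process with $\mathbb E X(1)=0$, $\mathbb E X(1)^2=1$ and $\mathbb E X(1)^4<\infty$. For a process $Y$ put $\Delta_i^kY=Y(\tfrac ik)-Y(\tfrac{i-1}k)$, $i=1,\dots,k$. Let $U,U_1,\dots,U_k$ be standard uniform random variables, let $b$ be a standard Brownian bridge on $[0,1]$ and let $\beta_1,\dots,\beta_k$ be Brownian bridges on $[0,1/k]$, such that $X,U,U_1,\dots,U_k,b,\beta_1,\dots,\beta_k$ are mutually independent. *Reordering coupling.* Let $h:\mathbb R^2\to\mathbb R$ be any measurable function such that $h(X(1),U)$ is standard normal, and let $W'(t)=b(t)+t\,h(X(1),U)$, $t\in[0,1]$. Let $\pi$ be the (almost surely unique) random permutation of $\{1,\dots,k\}$ such that almost surely, for all $i\ne j$, $\Delta^k_{\pi(i)}W'<\Delta^k_{\pi(j)}W'$ if and only if either $\Delta_i^kX<\Delta_j^kX$, or $\Delta_i^kX=\Delta_j^kX$ and $U_i<U_j$. Define $W(0)=0$ and $$W(t)=W(\tfrac{i-1}k)+W'\big(\tfrac{\pi(i)-1}k+t-\tfrac{i-1}k\big)-W'\big(\tfrac{\pi(i)-1}k\big),\qquad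 \tfrac{i-1}k<t\le\tfrac ik,\quad i=1,\dots,k.$$ *Comonotonic coupling of increments.* Let $\Phi_k$ be the distribution function of $\mathcal N(0,1/k)$, let $\Phi_k^{-1}(p)=\inf\{x:\Phi_k(x)\ge p\}$, and put $\xi_i=h_k(\Delta_i^kX,U_i)$ with $h_k(x,u)=\Phi_k^{-1}\big(\mathbb P(X(1/k)<x)+u\,\mathbb P(X(1/k)=x)\big)$. Define $\widehat W(0)=0$ and $$\widehat W(t)=\widehat W(\tfrac{i-1}k)+\beta_i\big(t-\tfrac{i-1}k\big)+k\big(t-\tfrac{i-1}k\big)\xi_i,\qquad \tfrac{i-1}k<t\le\tfrac ik,\quad i=1,\dots,k.$$ Then $$\mathbb E\max_{1\le i\le k}\Big|\big[W(\tfrac ik)-\tfrac ikW(1)\big]-\big[\widehat W(\tfrac ik)-\tfrac ik\widehat W(1)\big]\Big|^2=O\!\left(\frac{\log\log k}{k}\right),\qquad k\to\infty,$$ uniformly over all such processes $X$; that is, there are constants $C$ and $k_0$ such that for every $k\ge k_0$ and every such $X$ (and every choice of $h$ and of the remaining ingredients above) the left-hand side is at most $C\log\log k/k$. -/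

import Mathlib

open MeasureTheory ProbabilityTheory Filter Topology Set
open scoped NNReal

noncomputable section

/-- A real-valued Lévy process on `[0, ∞)`: it starts at zero, has independent and stationary
increments, and has càdlàg paths, almost surely. -/
structure IsLevyProcess {Ω : Type*} [MeasurableSpace Ω] (X : ℝ≥0 → Ω → ℝ) (P : Measure Ω) :
    Prop where
  measurable : ∀ t, Measurable (X t)
  zero : ∀ᵐ ω ∂P, X 0 ω = 0
  indep : HasIndepIncrements X P
  stationary : ∀ s t : ℝ≥0, IdentDistrib (fun ω => X (s + t) ω - X s ω) (X t) P P
  cadlag : ∀ᵐ ω ∂P, ∀ t : ℝ≥0, ContinuousWithinAt (fun s => X s ω) (Ici t) t ∧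
    ∃ l : ℝ, Tendsto (fun s => X s ω) (𝓝[<] t) (𝓝 l)

/-- A Brownian bridge on the time interval `[0, T]`, from `0` to `0`: a centred Gaussian process
with covariance `s (T - t) / T` for `s ≤ t` and almost surely continuous paths.
The values of `b` outside `[0, T]` play no role. -/
structure IsBrownianBridge {Ω : Type*} [MeasurableSpace Ω] (T : ℝ) (b : ℝ → Ω → ℝ)
    (P : Measure Ω) : Prop where
  measurable : ∀ t ∈ Icc 0 T, Measurable (b t)
  gaussian : IsGaussianProcess (fun t : Icc (0 : ℝ) T => b t) P
  mean : ∀ t ∈ Icc 0 T, ∫ ω, b t ω ∂P = 0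
  cov : ∀ s t : ℝ, 0 ≤ s → s ≤ t → t ≤ T → covariance (b s) (b t) P = s * (T - t) / T
  continuous : ∀ᵐ ω ∂P, ContinuousOn (fun t => b t ω) (Icc 0 T)

/-- Labels of the independent ingredients of the construction: the Lévy process, the uniform
variable used at the end-point, the uniform variables attached to the increments, the bridge on
`[0, 1]`, and the bridges on `[0, 1/k]`. -/
inductive Source (k : ℕ) : Type
  | levy : Source k
  | endpoint : Source k
  | tie (i : Fin k) : Source k
  | bridge : Source k
  | segment (i : Fin k) : Source k

/-- The σ-algebra generated by each of the ingredients. -/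
@[reducible] def Source.sigma {Ω : Type*} {k : ℕ} (X : ℝ≥0 → Ω → ℝ) (U : Ω → ℝ) (V : Fin k → Ω → ℝ)
    (b : ℝ → Ω → ℝ) (β : Fin k → ℝ → Ω → ℝ) : Source k → MeasurableSpace Ω
  | .levy => ⨆ t : ℝ≥0, MeasurableSpace.comap (X t) inferInstance
  | .endpoint => MeasurableSpace.comap U inferInstance
  | .tie i => MeasurableSpace.comap (V i) inferInstance
  | .bridge => ⨆ t : Icc (0 : ℝ) 1, MeasurableSpace.comap (b t) inferInstance
  | .segment i => ⨆ t : Icc (0 : ℝ) (1 / k), MeasurableSpace.comap (β i t) inferInstance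

/-- The ingredients of the two couplings with `k` increments: a Lévy process `X` with
`E X(1) = 0`, `E X(1)² = 1`, `E X(1)⁴ < ∞`, standard uniforms `U, V₁, …, V_k`, a standard Brownian
bridge `b` on `[0, 1]` and Brownian bridges `β₁, …, β_k` on `[0, 1/k]`, all mutually
independent. -/
structure IsCouplingInput {Ω : Type*} [MeasurableSpace Ω] (P : Measure Ω) (k : ℕ)
    (X : ℝ≥0 → Ω → ℝ) (U : Ω → ℝ) (V : Fin k → Ω → ℝ) (b : ℝ → Ω → ℝ)
    (β : Fin k → ℝ → Ω → ℝ) : Prop where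
  levy : IsLevyProcess X P
  fourth_moment : MemLp (X 1) 4 P
  mean : ∫ ω, X 1 ω ∂P = 0
  second_moment : ∫ ω, X 1 ω ^ 2 ∂P = 1
  measurable_U : Measurable U
  uniform_U : pdf.IsUniform U (Icc 0 1) P
  measurable_V : ∀ i, Measurable (V i)
  uniform_V : ∀ i, pdf.IsUniform (V i) (Icc 0 1) P
  bridge : IsBrownianBridge 1 b P
  segment : ∀ i, IsBrownianBridge (1 / k) (β i) P
  indep : iIndep (Source.sigma X U V b β) P

/-- The increment of a process over the `i`-th interval `[i/k, (i+1)/k]`, `i = 0, …, k - 1`. -/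
def gridIncrement {Ω T : Type*} [DivisionSemiring T] (k : ℕ) (Y : T → Ω → ℝ) (i : Fin k)
    (ω : Ω) : ℝ :=
  Y (((i : ℕ) + 1) / k) ω - Y ((i : ℕ) / k) ω

/-- The Brownian motion `W'` on `[0, 1]` with bridge `b` and end-point `h (X(1), U)`. -/
def endpointBM {Ω : Type*} (h : ℝ → ℝ → ℝ) (X : ℝ≥0 → Ω → ℝ) (U : Ω → ℝ) (b : ℝ → Ω → ℝ)
    (t : ℝ) (ω : Ω) : ℝ :=
  b t ω + t * h (X 1 ω) (U ω)

/-- `π` is a random permutation such that, almost surely, the increments `Δ_{π(i)} W'` are ordered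
as the increments `Δ_i X`, ties being resolved by the `V_i`. -/
structure IsMatchingPermutation {Ω : Type*} [MeasurableSpace Ω] (P : Measure Ω) (k : ℕ)
    (X : ℝ≥0 → Ω → ℝ) (V : Fin k → Ω → ℝ) (W' : ℝ → Ω → ℝ) (π : Ω → Equiv.Perm (Fin k)) :
    Prop where
  measurable : ∀ σ : Equiv.Perm (Fin k), MeasurableSet {ω | π ω = σ}
  order : ∀ᵐ ω ∂P, ∀ i j : Fin k, i ≠ j →
    (gridIncrement k W' (π ω i) ω < gridIncrement k W' (π ω j) ω ↔
      gridIncrement k X i ω < gridIncrement k X j ω ∨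
        (gridIncrement k X i ω = gridIncrement k X j ω ∧ V i ω < V j ω))

/-- The path on `[0, 1]` that starts at `0` and follows, on `(i/k, (i+1)/k]`, the segment `p i`
(parametrised by `(0, 1/k]`), added to the value at `i/k`; see `concat_zero`, `concat_step`. -/
def concat (k : ℕ) (p : Fin k → ℝ → ℝ) (t : ℝ) : ℝ :=
  ∑ j : Fin k, if (j : ℝ) / k < t then p j (min (t - (j : ℝ) / k) (1 / k)) else 0

/-- The reordered process `W`: on the `i`-th interval it follows the evolution of `W'` over the
`π(i)`-th interval. -/
def reorderedBM {Ω : Type*} (k : ℕ) (W' : ℝ → Ω → ℝ) (π : Ω → Equiv.Perm (Fin k))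
    (t : ℝ) (ω : Ω) : ℝ :=
  concat k (fun i s => W' ((π ω i : ℝ) / k + s) ω - W' ((π ω i : ℝ) / k) ω) t

/-- The left inverse `F⁻¹(p) = inf {x | F(x) ≥ p}` of the distribution function of `μ`. -/
def quantile (μ : Measure ℝ) (p : ℝ) : ℝ :=
  sInf {x : ℝ | p ≤ cdf μ x}

/-- The comonotonic transport `h(x, u) = F₂⁻¹(P(ζ₁ < x) + u P(ζ₁ = x))`, where `ζ₁` has law `μ₁`
and `F₂` is the distribution function of `μ₂`. -/
def comonotoneMap (μ₁ μ₂ : Measure ℝ) (x u : ℝ) : ℝ :=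
  quantile μ₂ (μ₁.real (Iio x) + u * μ₁.real {x})

/-- The process `Ŵ`, whose increments over the grid are comonotonically coupled with those of `X`
and whose interval bridges are the `β i`. -/
def comonotoneBM {Ω : Type*} [MeasurableSpace Ω] (P : Measure Ω) (k : ℕ) (X : ℝ≥0 → Ω → ℝ)
    (V : Fin k → Ω → ℝ) (β : Fin k → ℝ → Ω → ℝ) (t : ℝ) (ω : Ω) : ℝ :=
  concat k (fun i s => β i s ω + k * s *
    comonotoneMap (P.map (X (1 / k))) (gaussianReal 0 (1 / k)) (gridIncrement k X i ω) (V i ω)) t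

theorem concat_zero (k : ℕ) (p : Fin k → ℝ → ℝ) : concat k p 0 = 0 := by
  refine Finset.sum_eq_zero fun j _ => if_neg (not_lt.2 ?_)
  positivity

theorem concat_step (k : ℕ) (p : Fin k → ℝ → ℝ) (i : Fin k) (t : ℝ) (h₁ : (i : ℝ) / k < t)
    (h₂ : t ≤ ((i : ℝ) + 1) / k) :
    concat k p t = concat k p ((i : ℝ) / k) + p i (t - (i : ℝ) / k) := by
  have hk : (0 : ℝ) < k := by exact_mod_cast i.pos
  have key : ∀ j : Fin k,
      (if (j : ℝ) / k < t then p j (min (t - (j : ℝ) / k) (1 / k)) else 0) =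
      (if (j : ℝ) / k < (i : ℝ) / k then p j (min ((i : ℝ) / k - (j : ℝ) / k) (1 / k)) else 0) +
        (if j = i then p i (t - (i : ℝ) / k) else 0) := by
    intro j
    rcases lt_trichotomy j i with hj | rfl | hj
    · have h3 : (j : ℝ) + 1 ≤ i := by exact_mod_cast hj
      have h4 : ((j : ℝ) + 1) / k ≤ (i : ℝ) / k := by gcongr
      rw [add_div] at h4
      have h5 : (0 : ℝ) < 1 / k := by positivity
      rw [if_pos (by linarith), if_pos (by linarith), if_neg hj.ne, min_eq_right (by linarith),
        min_eq_right (by linarith), add_zero]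
    · rw [add_div] at h₂
      rw [if_pos h₁, if_neg (lt_irrefl _), if_pos rfl, min_eq_left (by linarith), zero_add]
    · have h3 : (i : ℝ) + 1 ≤ j := by exact_mod_cast hj
      have h4 : ((i : ℝ) + 1) / k ≤ (j : ℝ) / k := by gcongr
      have h5 : (i : ℝ) / k ≤ (j : ℝ) / k := div_le_div_of_nonneg_right (by linarith) hk.le
      rw [if_neg (by linarith), if_neg (by linarith), if_neg hj.ne', add_zero]
  unfold concat
  rw [Finset.sum_congr rfl fun j _ => key j, Finset.sum_add_distrib]
  simp

/-- The value at time `t` of the bridge `Y(t) - t Y(1)` of a process `Y`. -/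
def bridgeOf {Ω : Type*} (Y : ℝ → Ω → ℝ) (t : ℝ) (ω : Ω) : ℝ :=
  Y t ω - t * Y 1 ω

/-- The squared maximal distance over the grid points `i/k`, `1 ≤ i ≤ k`, between the bridges of
two processes. -/
def maxSqBridgeDist {Ω : Type*} (k : ℕ) (Y Z : ℝ → Ω → ℝ) (ω : Ω) : ℝ :=
  ⨆ i : Fin k, |bridgeOf Y (((i : ℝ) + 1) / k) ω - bridgeOf Z (((i : ℝ) + 1) / k) ω| ^ 2

end

/-! At the grid points, the bridge of a concatenated path is a partial sum of its centred grid
increments. Centring removes the end-point term `h (X 1) U / k` common to all increments of `W'`, so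
the quantity to bound is the maximal squared partial sum of `η (π j) - ξ j`. Here `η` are the
centred increments of `b` and `ξ` the centred comonotone increments (`ae_maxSqBridgeDist_eq`).

The comonotone map is monotone, so `π` matches `η` to `ξ` in order (`ae_orderMatches`). The tuple of
comonotone increments is an `N(0, 1/k)` sample, it is independent of `b`, and `η` is distributed as
a centred `N(0, 1/k)` sample (`map_xi`, `indepFun_xi_bridge`, `map_centred_gridIncrement`). The law
of `X` has now disappeared, which is why the bound is uniform: what remains is a statement about two
independent Gaussian samples.

By exchangeability the matched differences appear in uniformly random order. For a sequence of sum
zero in such an order, the maximal squared partial sum is on average at most 32 times the sum of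
squares (`sum_iSup_sq_partialSum_le`): partial sums divided by the number of remaining terms form a
martingale, so Doob's inequality applies. The expected maximum is thus bounded by the expected
quadratic cost of the monotone matching of the samples (`lintegral_matchedMax_le`).

This cost is `O(log log k)` for standard Gaussians, and scaling contributes `1/k`. One sample is
turned into the other coordinate by coordinate; an inequality of Efron-Stein type bounds the
expected cost by the sum of the costs of single replacements, and such a replacement costs only the
squared gaps that it crosses. This yields a double integral in the distribution function
(`lintegral_matchCost_le`). In the Gaussian case Mills' bound reduces it to `∫ dv / v` up to `√(2
log k)`, the source of the iterated logarithm. -/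

/-! ### Doob's inequality along a path. -/

/-- The running maximum of a real sequence. -/
noncomputable def runningMax (x : ℕ → ℝ) : ℕ → ℝ
  | 0 => x 0
  | n + 1 => max (runningMax x n) (x (n + 1))

theorem le_runningMax (x : ℕ → ℝ) {i n : ℕ} (h : i ≤ n) : x i ≤ runningMax x n := by
  induction n with
  | zero => obtain rfl : i = 0 := by omega
            exact le_rfl
  | succ n ih =>
    rcases h.lt_or_eq with h | rfl
    · exact (ih (by omega)).trans (le_max_left _ _)
    · exact le_max_right _ _

theorem runningMax_congr {x y : ℕ → ℝ} {n : ℕ} (h : ∀ i ≤ n, x i = y i) :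
    runningMax x n = runningMax y n := by
  induction n with
  | zero => exact h 0 le_rfl
  | succ n ih => simp only [runningMax, ih fun i hi => h i (by omega), h (n + 1) le_rfl]

/-- Induction: a step that stays below the maximum changes both sides equally, and a new record
enlarges the slack by the square of its excess over the old maximum. -/
theorem sq_runningMax_add_le (x : ℕ → ℝ) (n : ℕ) :
    runningMax x n ^ 2 + 2 * ∑ i ∈ Finset.range n, runningMax x i * (x (i + 1) - x i) ≤
      2 * runningMax x n * x n := by
  induction n with
  | zero => simp only [runningMax, Finset.range_zero, Finset.sum_empty]; nlinarith [sq_nonneg (x 0)]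
  | succ n ih =>
    rw [Finset.sum_range_succ]
    simp only [runningMax]
    rcases le_total (x (n + 1)) (runningMax x n) with h | h
    · rw [max_eq_left h]; nlinarith
    · rw [max_eq_right h]; nlinarith [sq_nonneg (x (n + 1) - runningMax x n)]

/-- The pathwise form of Doob's `L²` inequality. -/
theorem sq_runningMax_le (x : ℕ → ℝ) (n : ℕ) :
    runningMax x n ^ 2 ≤
      4 * x n ^ 2 - 4 * ∑ i ∈ Finset.range n, runningMax x i * (x (i + 1) - x i) := by
  -- With `M` the maximum, `2 M x ≤ M² / 2 + 2 x²`; half of `M²` is absorbed on the left.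
  nlinarith [sq_runningMax_add_le x n, sq_nonneg (runningMax x n - 2 * x n)]

/-! ### Partial sums in uniformly random order. -/

namespace PermutedSum

variable {k : ℕ}

/-- The sum of the first `n` terms of `d ∘ τ`. -/
def partialSum (d : Fin k → ℝ) (n : ℕ) (τ : Equiv.Perm (Fin k)) : ℝ :=
  ∑ j ∈ Finset.univ.filter fun j : Fin k => (j : ℕ) < n, d (τ j)

theorem partialSum_succ (d : Fin k → ℝ) (i : Fin k) (τ : Equiv.Perm (Fin k)) :
    partialSum d (i + 1) τ = partialSum d i τ + d (τ i) := by
  unfold partialSum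
  have : (Finset.univ.filter fun j : Fin k => (j : ℕ) < i + 1) =
      insert i (Finset.univ.filter fun j : Fin k => (j : ℕ) < i) := by
    ext j; simp only [Finset.mem_filter_univ, Finset.mem_insert, Fin.ext_iff]; omega
  rw [this, Finset.sum_insert (by simp), add_comm]

/-- Invariance under transpositions of positions from `n` on plays the role of measurability with
respect to the first `n` values. -/
theorem partialSum_mul_swap (d : Fin k → ℝ) {n : ℕ} {i j : Fin k} (hi : n ≤ i) (hj : i ≤ j)
    (τ : Equiv.Perm (Fin k)) :
    partialSum d n (τ * Equiv.swap i j) = partialSum d n τ := by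
  refine Finset.sum_congr rfl fun l hl => ?_
  have hj' : (i : ℕ) ≤ j := hj
  simp only [Finset.mem_filter_univ] at hl
  rw [Equiv.Perm.mul_apply, Equiv.swap_apply_of_ne_of_ne] <;>
    (rintro rfl; omega)

theorem sum_Ici_eq (d : Fin k → ℝ) (hd : ∑ i, d i = 0) (i : Fin k) (τ : Equiv.Perm (Fin k)) :
    ∑ j ∈ Finset.Ici i, d (τ j) = - partialSum d i τ := by
  have h : ∑ j, d (τ j) = 0 := by rw [Equiv.sum_comp τ d, hd]
  rw [← Finset.sum_filter_add_sum_filter_not _ (fun j : Fin k => (j : ℕ) < i)] at h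
  have : (Finset.univ.filter fun j : Fin k => ¬ (j : ℕ) < i) = Finset.Ici i := by
    ext j; simp only [Finset.mem_filter_univ, Finset.mem_Ici, not_lt, Fin.le_def]
  rw [this] at h
  unfold partialSum
  linarith

/-- Averaging over the transpositions that fix the positions before `i`. -/
theorem sum_mul_eq_sum_mul_swap (i : Fin k) (G H : Equiv.Perm (Fin k) → ℝ)
    (hG : ∀ τ, ∀ j, i ≤ j → G (τ * Equiv.swap i j) = G τ) :
    ((k : ℝ) - i) * ∑ τ, G τ * H τ =
      ∑ τ, G τ * ∑ j ∈ Finset.Ici i, H (τ * Equiv.swap i j) := by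
  simp_rw [Finset.mul_sum (Finset.Ici i)]
  rw [Finset.sum_comm]
  have : ∀ j ∈ Finset.Ici i, ∑ τ, G τ * H (τ * Equiv.swap i j) = ∑ τ, G τ * H τ := by
    intro j hj
    rw [← Equiv.sum_comp (Equiv.mulRight (Equiv.swap i j)) fun τ => G τ * H τ]
    refine Finset.sum_congr rfl fun τ _ => ?_
    simp only [Equiv.coe_mulRight, hG τ j (Finset.mem_Ici.1 hj)]
  rw [Finset.sum_congr rfl this, Finset.sum_const, Fin.card_Ici, nsmul_eq_mul,
    Nat.cast_sub i.2.le]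

/-- Given the past, the next term is uniform among the remaining ones, whose sum is minus the
present partial sum. -/
theorem sum_mul_apply (d : Fin k → ℝ) (hd : ∑ i, d i = 0) (i : Fin k)
    (G : Equiv.Perm (Fin k) → ℝ) (hG : ∀ τ, ∀ j, i ≤ j → G (τ * Equiv.swap i j) = G τ) :
    ((k : ℝ) - i) * ∑ τ, G τ * d (τ i) = - ∑ τ, G τ * partialSum d i τ := by
  rw [sum_mul_eq_sum_mul_swap i G (fun τ => d (τ i)) hG, ← Finset.sum_neg_distrib]
  refine Finset.sum_congr rfl fun τ _ => ?_
  simp only [Equiv.Perm.mul_apply, Equiv.swap_apply_left, sum_Ici_eq d hd, mul_neg]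

theorem sum_sq_apply (d : Fin k → ℝ) (i : Fin k) :
    (k : ℝ) * ∑ τ : Equiv.Perm (Fin k), d (τ i) ^ 2 = k.factorial * ∑ j, d j ^ 2 := by
  have h : ∀ j : Fin k, ∑ τ : Equiv.Perm (Fin k), d (τ j) ^ 2 =
      ∑ τ : Equiv.Perm (Fin k), d (τ i) ^ 2 := by
    intro j
    rw [← Equiv.sum_comp (Equiv.mulRight (Equiv.swap i j)) fun τ => d (τ j) ^ 2]
    simp
  have h2 : ∑ j : Fin k, ∑ τ : Equiv.Perm (Fin k), d (τ j) ^ 2 =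
      k.factorial * ∑ j, d j ^ 2 := by
    rw [Finset.sum_comm]
    simp_rw [fun τ : Equiv.Perm (Fin k) => Equiv.sum_comp τ fun j => d j ^ 2]
    simp [Fintype.card_perm]
  rw [← h2, Finset.sum_congr rfl fun j _ => h j]
  simp

/-- Sampling without replacement: by `sum_mul_apply` each new term is negatively correlated with the
partial sum, so the variance is at most that of independent draws. -/
theorem sum_sq_partialSum_le (d : Fin k → ℝ) (hd : ∑ i, d i = 0) (n : ℕ) (hn : n ≤ k) :
    (k : ℝ) * ∑ τ, partialSum d n τ ^ 2 ≤ n * (k.factorial * ∑ j, d j ^ 2) := by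
  induction n with
  | zero => simp [partialSum]
  | succ n ih =>
    have ih := ih (by omega)
    have h1 := sum_mul_apply d hd ⟨n, hn⟩ (partialSum d n)
      fun τ j hj => partialSum_mul_swap d le_rfl hj τ
    have h2 := sum_sq_apply d ⟨n, hn⟩
    have h3 : ∑ τ, partialSum d n τ * d (τ ⟨n, hn⟩) ≤ 0 := by
      have hpos : (0 : ℝ) < (k : ℝ) - n := by
        have : (n : ℝ) < k := by exact_mod_cast hn
        linarith
      have : 0 ≤ ∑ τ, partialSum d n τ * partialSum d n τ :=
        Finset.sum_nonneg fun τ _ => mul_self_nonneg _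
      simp only at h1
      by_contra hcon
      push Not at hcon
      nlinarith [mul_pos hpos hcon]
    have h4 : ∑ τ, partialSum d (n + 1) τ ^ 2 = ∑ τ, partialSum d n τ ^ 2 +
        2 * ∑ τ, partialSum d n τ * d (τ ⟨n, hn⟩) + ∑ τ : Equiv.Perm (Fin k), d (τ ⟨n, hn⟩) ^ 2 := by
      rw [Finset.mul_sum, ← Finset.sum_add_distrib, ← Finset.sum_add_distrib]
      refine Finset.sum_congr rfl fun τ _ => ?_
      have := partialSum_succ d ⟨n, hn⟩ τ
      simp only at this
      rw [this]; ring
    rw [h4]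
    push_cast
    have hk : (0 : ℝ) ≤ k := Nat.cast_nonneg k
    nlinarith [mul_nonneg hk (neg_nonneg.2 h3)]

/-- The normalised absolute partial sums, a submartingale under a uniform random permutation. -/
noncomputable def scaledSum (d : Fin k → ℝ) (τ : Equiv.Perm (Fin k)) (n : ℕ) : ℝ :=
  |partialSum d n τ| / ((k : ℝ) - n)

theorem scaledSum_nonneg (d : Fin k → ℝ) (τ : Equiv.Perm (Fin k)) {n : ℕ} (h : n ≤ k) :
    0 ≤ scaledSum d τ n :=
  div_nonneg (abs_nonneg _) (sub_nonneg.2 (by exact_mod_cast h))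

/-- The submartingale property, tested against the nonnegative running maximum, which depends only
on the past. It is the triangle inequality for the average of `|S + d (τ j)|` over the remaining
`j`, as these numbers sum to `(k - n - 1) S`. -/
theorem sum_runningMax_mul_nonneg (d : Fin k → ℝ) (hd : ∑ i, d i = 0) (n : ℕ) (hn : n + 1 < k) :
    0 ≤ ∑ τ, runningMax (scaledSum d τ) n * (scaledSum d τ (n + 1) - scaledSum d τ n) := by
  have hk : (n : ℝ) + 1 < k := by exact_mod_cast hn
  set i : Fin k := ⟨n, by omega⟩ with hi
  have hm : ∀ τ, 0 ≤ runningMax (scaledSum d τ) n := fun τ =>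
    (scaledSum_nonneg d τ (by omega)).trans (le_runningMax (scaledSum d τ) le_rfl)
  have h := sum_mul_eq_sum_mul_swap i (fun τ => runningMax (scaledSum d τ) n)
    (fun τ => scaledSum d τ (n + 1)) fun τ j hj => runningMax_congr fun l hl => by
      rw [scaledSum, scaledSum, partialSum_mul_swap d hl hj]
  have hval : (i : ℝ) = n := rfl
  have key : ∀ τ, ((k : ℝ) - n) * scaledSum d τ n ≤
      ∑ j ∈ Finset.Ici i, scaledSum d (τ * Equiv.swap i j) (n + 1) := by
    intro τ
    have h1 : ∀ j ∈ Finset.Ici i, scaledSum d (τ * Equiv.swap i j) (n + 1) =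
        |partialSum d n τ + d (τ j)| / ((k : ℝ) - (n + 1)) := by
      intro j hj
      have h2 := partialSum_succ d i (τ * Equiv.swap i j)
      rw [partialSum_mul_swap d (n := i) le_rfl (Finset.mem_Ici.1 hj)] at h2
      simp only [hi, Equiv.Perm.mul_apply, Equiv.swap_apply_left] at h2
      rw [scaledSum, h2]
      push_cast
      rfl
    rw [Finset.sum_congr rfl h1, ← Finset.sum_div, scaledSum, mul_div_cancel₀ _ (by linarith),
      le_div_iff₀ (by linarith)]
    refine le_trans (le_of_eq ?_) (Finset.abs_sum_le_sum_abs _ _)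
    rw [Finset.sum_add_distrib, sum_Ici_eq d hd, Finset.sum_const, Fin.card_Ici, nsmul_eq_mul,
      Nat.cast_sub i.2.le, hval]
    have : ((k : ℝ) - n) * partialSum d n τ + -partialSum d (i : ℕ) τ =
      ((k : ℝ) - (n + 1)) * partialSum d n τ := by rw [hi]; ring
    rw [this, abs_mul, abs_of_pos (by linarith : (0 : ℝ) < (k : ℝ) - (n + 1)), mul_comm]
  rw [hval] at h
  have h3 : ((k : ℝ) - n) * ∑ τ, runningMax (scaledSum d τ) n * scaledSum d τ n ≤
      ((k : ℝ) - n) * ∑ τ, runningMax (scaledSum d τ) n * scaledSum d τ (n + 1) := by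
    rw [h, Finset.mul_sum]
    refine Finset.sum_le_sum fun τ _ => ?_
    calc _ = runningMax (scaledSum d τ) n * (((k : ℝ) - n) * scaledSum d τ n) := by ring
      _ ≤ _ := mul_le_mul_of_nonneg_left (key τ) (hm τ)
  have h4 := le_of_mul_le_mul_left h3 (by linarith)
  simp_rw [mul_sub, Finset.sum_sub_distrib]
  linarith

theorem sum_sq_runningMax_le (d : Fin k → ℝ) (hd : ∑ i, d i = 0) (n : ℕ) (hn : 2 * n ≤ k)
    (hk : 0 < k) :
    (k : ℝ) ^ 2 * ∑ τ, runningMax (scaledSum d τ) n ^ 2 ≤ 16 * (k.factorial * ∑ j, d j ^ 2) := by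
  have hk' : (0 : ℝ) < k := by exact_mod_cast hk
  have hn' : 2 * (n : ℝ) ≤ k := by exact_mod_cast hn
  have h1 : ∑ τ, runningMax (scaledSum d τ) n ^ 2 ≤ ∑ τ, 4 * scaledSum d τ n ^ 2 := by
    have h3 := Finset.sum_nonneg fun i (hi : i ∈ Finset.range n) =>
      sum_runningMax_mul_nonneg d hd i (by have := Finset.mem_range.1 hi; omega)
    rw [Finset.sum_comm] at h3
    have h4 := Finset.sum_le_sum fun τ (_ : τ ∈ Finset.univ) => sq_runningMax_le (scaledSum d τ) n
    rw [Finset.sum_sub_distrib, ← Finset.mul_sum _ _ (4 : ℝ), ← Finset.mul_sum _ _ (4 : ℝ)] at h4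
    rw [← Finset.mul_sum]
    linarith
  have h5 := sum_sq_partialSum_le d hd n (by omega)
  -- Doob contributes 4, and `k - n ≥ k / 2` contributes another 4.
  have h6 : ∀ τ, (k : ℝ) ^ 2 * (4 * scaledSum d τ n ^ 2) ≤ 16 * partialSum d n τ ^ 2 := by
    intro τ
    rw [scaledSum, div_pow, sq_abs, ← mul_assoc, mul_div_assoc', div_le_iff₀ (by nlinarith)]
    nlinarith [sq_nonneg (partialSum d n τ), mul_nonneg (sq_nonneg (partialSum d n τ))
      (by nlinarith : (0 : ℝ) ≤ 4 * ((k : ℝ) - n) ^ 2 - k ^ 2)]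
  have h7 : (k : ℝ) ^ 2 * ∑ τ, runningMax (scaledSum d τ) n ^ 2 ≤
      16 * ∑ τ, partialSum d n τ ^ 2 := by
    refine (mul_le_mul_of_nonneg_left h1 (by positivity)).trans ?_
    rw [Finset.mul_sum, Finset.mul_sum]
    exact Finset.sum_le_sum fun τ _ => h6 τ
  refine h7.trans (mul_le_mul_of_nonneg_left ?_ (by norm_num))
  have h8 : (0 : ℝ) ≤ k.factorial * ∑ j, d j ^ 2 := by positivity
  refine le_of_mul_le_mul_left (h5.trans ?_) hk'
  exact mul_le_mul_of_nonneg_right (by linarith) h8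

theorem sq_partialSum_le (d : Fin k → ℝ) (n m : ℕ) (h : n ≤ m) (hk : m < k)
    (τ : Equiv.Perm (Fin k)) :
    partialSum d n τ ^ 2 ≤ (k : ℝ) ^ 2 * runningMax (scaledSum d τ) m ^ 2 := by
  have hn : (n : ℝ) < k := by exact_mod_cast h.trans_lt hk
  rw [← sq_abs, ← mul_pow]
  refine pow_le_pow_left₀ (abs_nonneg _) ?_ 2
  have h1 := le_runningMax (scaledSum d τ) h
  rw [scaledSum, div_le_iff₀ (by linarith)] at h1
  have h0 : 0 ≤ runningMax (scaledSum d τ) m :=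
    (scaledSum_nonneg d τ (h.trans hk.le)).trans (le_runningMax (scaledSum d τ) h)
  nlinarith [mul_nonneg h0 (Nat.cast_nonneg n : (0 : ℝ) ≤ n)]

/-- Since the total is zero, a long partial sum is minus a short one read from the other end. -/
theorem partialSum_mul_rev (d : Fin k → ℝ) (hd : ∑ i, d i = 0) (n : ℕ) (hn : n ≤ k)
    (τ : Equiv.Perm (Fin k)) :
    partialSum d (k - n) (τ * Fin.revPerm) = - partialSum d n τ := by
  have h : ∑ j, d (τ j) = 0 := by rw [Equiv.sum_comp τ d, hd]
  rw [← Finset.sum_filter_add_sum_filter_not _ (fun j : Fin k => (j : ℕ) < n)] at h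
  have h2 : partialSum d (k - n) (τ * Fin.revPerm) =
      ∑ j ∈ Finset.univ.filter fun j : Fin k => ¬ (j : ℕ) < n, d (τ j) := by
    unfold partialSum
    refine Finset.sum_nbij' Fin.rev Fin.rev ?_ ?_ ?_ ?_ ?_ <;> simp [Fin.val_rev] <;> intros <;> omega
  rw [h2]
  unfold partialSum
  linarith

/-- Maximal inequality for the partial sums of a centred finite sequence in uniformly random
order. -/
theorem sum_iSup_sq_partialSum_le (d : Fin k → ℝ) (hd : ∑ i, d i = 0) :
    ∑ τ, ⨆ i : Fin k, partialSum d (i + 1) τ ^ 2 ≤ 32 * (k.factorial * ∑ j, d j ^ 2) := by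
  rcases Nat.eq_zero_or_pos k with rfl | hk
  · simp
  have : Nonempty (Fin k) := ⟨⟨0, hk⟩⟩
  -- The normalisation `1 / (k - n)` degenerates at the end, so the martingale is stopped halfway.
  -- Later partial sums are handled by reversal, which doubles 16 to 32.
  set m := k / 2 with hm
  have h1 : ∀ τ, ⨆ i : Fin k, partialSum d (i + 1) τ ^ 2 ≤
      (k : ℝ) ^ 2 * runningMax (scaledSum d τ) m ^ 2 +
        (k : ℝ) ^ 2 * runningMax (scaledSum d (τ * Fin.revPerm)) m ^ 2 := by
    intro τ
    refine ciSup_le fun i => ?_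
    by_cases hi : (i : ℕ) + 1 ≤ m
    · exact (sq_partialSum_le d _ m hi (by omega) τ).trans (le_add_of_nonneg_right (by positivity))
    · have h2 := partialSum_mul_rev d hd (i + 1) i.2 τ
      rw [← neg_sq, ← h2]
      exact (sq_partialSum_le d _ m (by omega) (by omega) _).trans
        (le_add_of_nonneg_left (by positivity))
  refine (Finset.sum_le_sum fun τ _ => h1 τ).trans ?_
  rw [Finset.sum_add_distrib, ← Finset.mul_sum, ← Finset.mul_sum]
  have h3 : ∑ τ : Equiv.Perm (Fin k), runningMax (scaledSum d (τ * Fin.revPerm)) m ^ 2 =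
      ∑ τ : Equiv.Perm (Fin k), runningMax (scaledSum d τ) m ^ 2 :=
    Equiv.sum_comp (Equiv.mulRight Fin.revPerm) fun τ => runningMax (scaledSum d τ) m ^ 2
  rw [h3]
  linarith [sum_sq_runningMax_le d hd m (by omega) hk]

end PermutedSum

/-! ### The quadratic cost of monotone matching. -/

/-- The quadratic cost of the monotone matching of two tuples of real numbers. -/
noncomputable def matchCost {k : ℕ} (x y : Fin k → ℝ) : ℝ :=
  ∑ r, (x (Tuple.sort x r) - y (Tuple.sort y r)) ^ 2

section MatchCost

variable {k : ℕ}

theorem matchCost_nonneg (x y : Fin k → ℝ) : 0 ≤ matchCost x y :=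
  Finset.sum_nonneg fun _ _ => sq_nonneg _

/-- Only the cross term depends on `σ`, and the rearrangement inequality controls it. -/
theorem sum_sq_sub_le_of_monovary {x y : Fin k → ℝ} (h : Monovary x y)
    (σ : Equiv.Perm (Fin k)) :
    ∑ i, (x i - y i) ^ 2 ≤ ∑ i, (x i - y (σ i)) ^ 2 := by
  have h1 := h.sum_mul_comp_perm_le_sum_mul (σ := σ)
  have h2 : ∑ i, y (σ i) ^ 2 = ∑ i, y i ^ 2 := Equiv.sum_comp σ fun i => y i ^ 2
  simp only [sub_sq, Finset.sum_add_distrib, Finset.sum_sub_distrib, h2, mul_assoc,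
    ← Finset.mul_sum]
  linarith

theorem matchCost_le (x y : Fin k → ℝ) (σ : Equiv.Perm (Fin k)) :
    matchCost x y ≤ ∑ i, (x i - y (σ i)) ^ 2 := by
  have hm : Monovary (x ∘ Tuple.sort x) (y ∘ Tuple.sort y) :=
    (Tuple.monotone_sort x).monovary (Tuple.monotone_sort y)
  have := sum_sq_sub_le_of_monovary hm ((Tuple.sort y)⁻¹ * σ * Tuple.sort x)
  refine this.trans_eq ?_
  rw [← Equiv.sum_comp (Tuple.sort x) fun i => (x i - y (σ i)) ^ 2]
  simp

theorem sum_sq_sub_le_matchCost {x y : Fin k → ℝ} {σ : Equiv.Perm (Fin k)}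
    (h : Monovary x (y ∘ σ)) : ∑ i, (x i - y (σ i)) ^ 2 ≤ matchCost x y := by
  refine (sum_sq_sub_le_of_monovary h (σ⁻¹ * Tuple.sort y * (Tuple.sort x)⁻¹)).trans_eq ?_
  rw [matchCost, ← Equiv.sum_comp (Tuple.sort x)]
  simp

/-- As a finite minimum of continuous functions the cost is visibly measurable, without any study of
the sorting permutation. -/
theorem matchCost_eq_inf' (x y : Fin k → ℝ) :
    matchCost x y = Finset.univ.inf' Finset.univ_nonempty
      fun σ : Equiv.Perm (Fin k) => ∑ i, (x i - y (σ i)) ^ 2 := by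
  refine le_antisymm (Finset.le_inf' _ _ fun σ _ => matchCost_le x y σ) ?_
  refine (Finset.inf'_le _ (Finset.mem_univ (Tuple.sort y * (Tuple.sort x)⁻¹))).trans_eq ?_
  rw [matchCost, ← Equiv.sum_comp (Tuple.sort x)]
  simp

theorem measurable_matchCost :
    Measurable fun p : (Fin k → ℝ) × (Fin k → ℝ) => matchCost p.1 p.2 := by
  simp_rw [matchCost_eq_inf']
  have := Finset.inf'_induction (s := Finset.univ) Finset.univ_nonempty
    (f := fun (σ : Equiv.Perm (Fin k)) (p : (Fin k → ℝ) × (Fin k → ℝ)) =>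
      ∑ i, (p.1 i - p.2 (σ i)) ^ 2) (p := Measurable) (fun _ h _ h' => h.inf h')
    fun σ _ => by fun_prop
  convert this using 1
  ext p
  simp

/-- The quadrilateral inequality for the matching cost. -/
theorem matchCost_quadrilateral (a b c d : Fin k → ℝ) :
    matchCost a d + matchCost b c ≤
      matchCost a b + matchCost c d + matchCost a c + matchCost b d := by
  simp only [matchCost, ← Finset.sum_add_distrib]
  refine Finset.sum_le_sum fun r _ => ?_
  nlinarith [sq_nonneg (a (Tuple.sort a r) + d (Tuple.sort d r) - b (Tuple.sort b r)
    - c (Tuple.sort c r))]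

/-- Twice the area of a triangle. The half-open constraints are chosen to fit the counting functions
`#{i | x i ≤ u}`. -/
theorem ofReal_sq_sub_eq_lintegral {a b : ℝ} (hab : a ≤ b) :
    ENNReal.ofReal ((b - a) ^ 2) =
      2 * ∫⁻ u, ∫⁻ v, if u < v ∧ a ≤ u ∧ v < b then (1 : ENNReal) else 0 := by
  have h1 : ∀ u : ℝ, ∫⁻ v, (if u < v ∧ a ≤ u ∧ v < b then (1 : ENNReal) else 0) =
      (Icc a b).indicator (fun u => ENNReal.ofReal (b - u)) u := by
    intro u
    have : ∀ v : ℝ, (if u < v ∧ a ≤ u ∧ v < b then (1 : ENNReal) else 0) =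
        {v | u < v ∧ a ≤ u ∧ v < b}.indicator 1 v := fun v => by simp [indicator]
    simp_rw [this]
    by_cases hu : u ∈ Icc a b
    · rw [indicator_of_mem hu]
      have h2 : {v | u < v ∧ a ≤ u ∧ v < b} = Ioo u b := by ext v; simp [hu.1]
      rw [h2, lintegral_indicator_one measurableSet_Ioo, Real.volume_Ioo]
    · rw [indicator_of_notMem hu]
      have h2 : {v | u < v ∧ a ≤ u ∧ v < b} = ∅ := by
        ext v; simp only [mem_ofPred_eq, mem_empty_iff_false, iff_false]
        rintro ⟨h3, h4, h5⟩; exact hu ⟨h4, by linarith⟩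
      simp [h2]
  simp_rw [h1]
  rw [lintegral_indicator measurableSet_Icc, ← ofReal_integral_eq_lintegral_ofReal]
  · rw [integral_Icc_eq_integral_Ioc, ← intervalIntegral.integral_of_le hab]
    have : ∫ u in a..b, (b - u) = (b - a) ^ 2 / 2 := by
      rw [intervalIntegral.integral_sub (by simp) (by simp)]
      simp only [intervalIntegral.integral_const, integral_id, smul_eq_mul]
      ring
    rw [this, show (2 : ENNReal) = ENNReal.ofReal 2 by simp, ← ENNReal.ofReal_mul (by norm_num)]
    congr 1; ring
  · exact (Continuous.integrableOn_Icc (by fun_prop))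
  · exact (ae_restrict_iff' measurableSet_Icc).2 (.of_forall fun u hu => by
      simpa using hu.2)

theorem ofReal_sq_sub_le_lintegral (a b : ℝ) :
    ENNReal.ofReal ((a - b) ^ 2) ≤ 2 * ∫⁻ u, ∫⁻ v,
      if u < v ∧ ((a ≤ u ∧ v < b) ∨ (b ≤ u ∧ v < a)) then (1 : ENNReal) else 0 := by
  rcases le_total a b with h | h
  · rw [← neg_sub, neg_sq, ofReal_sq_sub_eq_lintegral h]
    gcongr with u v
    split_ifs <;> grind
  · rw [ofReal_sq_sub_eq_lintegral h]
    gcongr with u v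
    split_ifs <;> grind

/-- The order statistic of rank `r` is at most `u` iff `r` is below the count at `u`, so the ranks
in question form an interval of integers; its length is a truncated difference. -/
theorem card_filter_sort (x y : Fin k → ℝ) (u v : ℝ) :
    (Finset.univ.filter fun r => x (Tuple.sort x r) ≤ u ∧ v < y (Tuple.sort y r)).card =
      (Finset.univ.filter fun i => x i ≤ u).card - (Finset.univ.filter fun i => y i ≤ v).card := by
  have hN : ∀ (x : Fin k → ℝ) (u : ℝ),
      (Finset.univ.filter fun r => (x ∘ Tuple.sort x) r ≤ u).card =
        (Finset.univ.filter fun i => x i ≤ u).card := by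
    intro x u
    refine Finset.card_bij (fun r _ => Tuple.sort x r) (by simp) (by simp) fun i hi => ?_
    exact ⟨(Tuple.sort x)⁻¹ i, by simpa using hi, by simp⟩
  rw [← hN x u, ← hN y v]
  set p := (Finset.univ.filter fun r => (x ∘ Tuple.sort x) r ≤ u).card with hp
  set q := (Finset.univ.filter fun r => (y ∘ Tuple.sort y) r ≤ v).card with hq
  have h1 : ∀ r : Fin k, x (Tuple.sort x r) ≤ u ↔ (r : ℕ) < p := fun r =>
    (Tuple.lt_card_le_iff_apply_le_of_monotone (Tuple.monotone_sort x)).symm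
  have h2 : ∀ r : Fin k, v < y (Tuple.sort y r) ↔ q ≤ (r : ℕ) := fun r => by
    rw [← not_lt, hq, Tuple.lt_card_le_iff_apply_le_of_monotone (Tuple.monotone_sort y), not_le]
    rfl
  have hpk : p ≤ k := (Finset.card_le_univ _).trans_eq (by simp)
  simp_rw [h1, h2]
  rw [← Nat.card_Ico]
  refine Finset.card_bij (fun r _ => (r : ℕ)) (by simp; tauto)
    (fun _ _ _ _ h => Fin.ext h) fun n hn => ?_
  rw [Finset.mem_Ico] at hn
  exact ⟨⟨n, by omega⟩, by simp; omega, rfl⟩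

theorem card_filter_update (x : Fin k → ℝ) (i : Fin k) (t u : ℝ) :
    (Finset.univ.filter fun j => Function.update x i t j ≤ u).card =
      ((Finset.univ.erase i).filter fun j => x j ≤ u).card + if t ≤ u then 1 else 0 := by
  have h : (Finset.univ : Finset (Fin k)) = insert i (Finset.univ.erase i) := by simp
  have h2 : ((Finset.univ.erase i).filter fun j => Function.update x i t j ≤ u) =
      (Finset.univ.erase i).filter fun j => x j ≤ u := by
    refine Finset.filter_congr fun j hj => ?_
    rw [Function.update_of_ne (Finset.ne_of_mem_erase hj)]
  conv_lhs => rw [h, Finset.filter_insert, h2]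
  simp only [Function.update_self]
  split_ifs
  · rw [Finset.card_insert_of_notMem (by simp)]
  · rfl

/-- Moving one point of a sample changes the matching cost by the squared gaps that it crosses,
here written as an area. -/
theorem ofReal_matchCost_update_le (x : Fin k → ℝ) (i : Fin k) (t : ℝ) :
    ENNReal.ofReal (matchCost x (Function.update x i t)) ≤ 2 * ∫⁻ u, ∫⁻ v,
      if u < v ∧ ((x i ≤ u ∧ v < t) ∨ (t ≤ u ∧ v < x i)) ∧ ∀ j, j ≠ i → x j ∉ Ioc u v
        then (1 : ENNReal) else 0 := by
  set y := Function.update x i t with hy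
  rw [matchCost, ENNReal.ofReal_sum_of_nonneg fun _ _ => sq_nonneg _]
  refine (Finset.sum_le_sum fun r _ => ofReal_sq_sub_le_lintegral _ _).trans ?_
  have hmeas : ∀ a b : ℝ, Measurable fun p : ℝ × ℝ =>
      if p.1 < p.2 ∧ ((a ≤ p.1 ∧ p.2 < b) ∨ (b ≤ p.1 ∧ p.2 < a)) then (1 : ENNReal) else 0 := by
    intro a b
    refine Measurable.ite ?_ measurable_const measurable_const
    measurability
  rw [← Finset.mul_sum, ← lintegral_finsetSum _ fun r _ => (hmeas _ _).lintegral_prod_right']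
  refine mul_le_mul_right (lintegral_mono fun u => ?_) _
  dsimp only
  rw [← lintegral_finsetSum _ fun r _ => by
    exact (hmeas (x (Tuple.sort x r)) (y (Tuple.sort y r))).comp measurable_prodMk_left]
  refine lintegral_mono fun v => ?_
  simp only [Finset.sum_boole]
  rcases le_or_gt v u with huv | huv
  · simp [huv.not_gt]
  simp only [huv, true_and]
  have hcard : (Finset.univ.filter fun r => (x (Tuple.sort x r) ≤ u ∧ v < y (Tuple.sort y r)) ∨
      (y (Tuple.sort y r) ≤ u ∧ v < x (Tuple.sort x r))).card ≤
      ((Finset.univ.filter fun i => x i ≤ u).card - (Finset.univ.filter fun i => y i ≤ v).card) +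
      ((Finset.univ.filter fun i => y i ≤ u).card - (Finset.univ.filter fun i => x i ≤ v).card) := by
    rw [← card_filter_sort, ← card_filter_sort, Finset.filter_or]
    exact Finset.card_union_le _ _
  have hx : ∀ u, (Finset.univ.filter fun j => x j ≤ u).card =
      ((Finset.univ.erase i).filter fun j => x j ≤ u).card + if x i ≤ u then 1 else 0 := by
    intro u
    simpa using card_filter_update x i (x i) u
  have hsub : ((Finset.univ.erase i).filter fun j => x j ≤ u) ⊆
      ((Finset.univ.erase i).filter fun j => x j ≤ v) := by
    intro j; simp only [Finset.mem_filter]; exact fun h => ⟨h.1, h.2.trans huv.le⟩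
  have hle := Finset.card_le_card hsub
  rw [hx, hx, card_filter_update, card_filter_update] at hcard
  have hnat : (Finset.univ.filter fun r => (x (Tuple.sort x r) ≤ u ∧ v < y (Tuple.sort y r)) ∨
      (y (Tuple.sort y r) ≤ u ∧ v < x (Tuple.sort x r))).card ≤
      if ((x i ≤ u ∧ v < t) ∨ (t ≤ u ∧ v < x i)) ∧ ∀ j, j ≠ i → x j ∉ Ioc u v then 1 else 0 := by
    refine hcard.trans ?_
    -- If no other point lies in `(u, v]`, the other points contribute equally to the counts at `u`
    -- and `v`, and only the moved point matters. One other point there already makes both truncated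
    -- differences vanish.
    by_cases hall : ∀ j, j ≠ i → x j ∉ Ioc u v
    · simp only [and_iff_left hall]
      grind
    · push Not at hall
      obtain ⟨j, hji, hj⟩ := hall
      have hlt := Finset.card_lt_card (hsub.ssubset_of_mem_notMem
        (a := j) (by simp [hji, hj.2]) (by simp [hj.1]))
      rw [if_neg (c := _ ∧ ∀ j, j ≠ i → x j ∉ Ioc u v) fun h => h.2 j hji hj]
      grind
  calc _ ≤ (((if ((x i ≤ u ∧ v < t) ∨ (t ≤ u ∧ v < x i)) ∧ ∀ j, j ≠ i → x j ∉ Ioc u v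
        then 1 else 0 : ℕ)) : ENNReal) := by exact_mod_cast hnat
    _ ≤ _ := by split_ifs <;> simp

end MatchCost

/-! ### Replacing a sample one coordinate at a time. -/

section EfronStein

variable {k : ℕ}

/-- Exchanging the two entries of the pairs with index in `S`. -/
def swapOn (S : Finset (Fin k)) (z : Fin k → ℝ × ℝ) (i : Fin k) : ℝ × ℝ :=
  if i ∈ S then (z i).swap else z i

/-- The first sample, with the coordinates in `S` replaced by those of the second sample. -/
def hybrid (S : Finset (Fin k)) (z : Fin k → ℝ × ℝ) (i : Fin k) : ℝ :=
  (swapOn S z i).1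

theorem measurable_swapOn (S : Finset (Fin k)) : Measurable (swapOn S) := by
  refine measurable_pi_lambda _ fun i => ?_
  unfold swapOn
  split_ifs <;> fun_prop

theorem measurable_hybrid (S : Finset (Fin k)) : Measurable (hybrid S) :=
  measurable_pi_lambda _ fun i => ((measurable_pi_apply i).comp (measurable_swapOn S)).fst

theorem measurePreserving_swapOn (μ : Measure ℝ) [IsProbabilityMeasure μ] (S : Finset (Fin k)) :
    MeasurePreserving (swapOn S) (Measure.pi fun _ : Fin k => μ.prod μ)
      (Measure.pi fun _ : Fin k => μ.prod μ) := by
  have h : ∀ i : Fin k, MeasurePreserving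
      (fun p : ℝ × ℝ => if i ∈ S then p.swap else p) (μ.prod μ) (μ.prod μ) := by
    intro i
    by_cases hi : i ∈ S
    · simpa only [hi, if_true] using Measure.measurePreserving_swap
    · simp only [hi, if_false]
      exact MeasurePreserving.id _
  exact measurePreserving_pi _ _ h

theorem hybrid_swapOn (S T : Finset (Fin k)) (z : Fin k → ℝ × ℝ) :
    hybrid S (swapOn T z) = hybrid (symmDiff S T) z := by
  ext i
  simp only [hybrid, swapOn, Finset.mem_symmDiff]
  by_cases h1 : i ∈ S <;> by_cases h2 : i ∈ T <;> simp [h1, h2]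

theorem measurable_ofReal_matchCost_hybrid (S T : Finset (Fin k)) :
    Measurable fun z : Fin k → ℝ × ℝ => ENNReal.ofReal (matchCost (hybrid S z) (hybrid T z)) :=
  (measurable_matchCost.comp
    ((measurable_hybrid S).prodMk (measurable_hybrid T))).ennreal_ofReal

/-- Exchanging the entries of the pairs in `S` preserves the law, so the expected cost between two
hybrids depends only on the symmetric difference of their index sets. -/
theorem lintegral_matchCost_hybrid (μ : Measure ℝ) [IsProbabilityMeasure μ]
    (S T : Finset (Fin k)) :
    ∫⁻ z, ENNReal.ofReal (matchCost (hybrid S z) (hybrid T z)) ∂(Measure.pi fun _ => μ.prod μ) =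
      ∫⁻ z, ENNReal.ofReal (matchCost (hybrid ∅ z) (hybrid (symmDiff T S) z))
        ∂(Measure.pi fun _ => μ.prod μ) := by
  rw [← (measurePreserving_swapOn μ S).lintegral_comp (measurable_ofReal_matchCost_hybrid _ _)]
  simp only [hybrid_swapOn]
  simp [symmDiff]

/-- The quadrilateral inequality is applied to the hybrids of `∅`, `S`, `{i}` and `insert i S`. By
symmetry both diagonals have the same expectation, and so do opposite sides; halving gives
subadditivity. -/
theorem lintegral_matchCost_insert_le (μ : Measure ℝ) [IsProbabilityMeasure μ]
    (S : Finset (Fin k)) (i : Fin k) (hi : i ∉ S) :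
    ∫⁻ z, ENNReal.ofReal (matchCost (hybrid ∅ z) (hybrid (insert i S) z))
        ∂(Measure.pi fun _ => μ.prod μ) ≤
      ∫⁻ z, ENNReal.ofReal (matchCost (hybrid ∅ z) (hybrid {i} z))
        ∂(Measure.pi fun _ => μ.prod μ) +
      ∫⁻ z, ENNReal.ofReal (matchCost (hybrid ∅ z) (hybrid S z))
        ∂(Measure.pi fun _ => μ.prod μ) := by
  set A : Finset (Fin k) → ENNReal := fun T =>
    ∫⁻ z, ENNReal.ofReal (matchCost (hybrid ∅ z) (hybrid T z)) ∂(Measure.pi fun _ => μ.prod μ)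
  change A (insert i S) ≤ A {i} + A S
  have hm := measurable_ofReal_matchCost_hybrid (k := k)
  have h1 : symmDiff {i} S = insert i S := by
    ext j; simp only [Finset.mem_symmDiff, Finset.mem_singleton, Finset.mem_insert]; grind
  have h2 : symmDiff (insert i S) {i} = S := by
    ext j; simp only [Finset.mem_symmDiff, Finset.mem_singleton, Finset.mem_insert]; grind
  have h3 : symmDiff (insert i S) S = {i} := by
    ext j; simp only [Finset.mem_symmDiff, Finset.mem_singleton, Finset.mem_insert]; grind
  have key : A (insert i S) + A (insert i S) ≤ A S + A S + A {i} + A {i} := by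
    have e1 := lintegral_matchCost_hybrid μ S {i}
    have e2 := lintegral_matchCost_hybrid μ {i} (insert i S)
    have e3 := lintegral_matchCost_hybrid μ S (insert i S)
    rw [h1] at e1
    rw [h2] at e2
    rw [h3] at e3
    simp only [A]
    nth_rewrite 2 [← e1]
    nth_rewrite 2 [← e2]
    nth_rewrite 2 [← e3]
    rw [← lintegral_add_right _ (hm _ _), ← lintegral_add_right _ (hm _ _),
      ← lintegral_add_right _ (hm _ _), ← lintegral_add_right _ (hm _ _)]
    refine lintegral_mono fun z => ?_
    have hn := matchCost_nonneg (k := k)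
    rw [← ENNReal.ofReal_add (hn _ _) (hn _ _), ← ENNReal.ofReal_add (hn _ _) (hn _ _),
      ← ENNReal.ofReal_add (add_nonneg (hn _ _) (hn _ _)) (hn _ _),
      ← ENNReal.ofReal_add (add_nonneg (add_nonneg (hn _ _) (hn _ _)) (hn _ _)) (hn _ _)]
    exact ENNReal.ofReal_le_ofReal (matchCost_quadrilateral _ _ _ _)
  have key2 : 2 * A (insert i S) ≤ 2 * (A {i} + A S) := by
    calc _ = A (insert i S) + A (insert i S) := two_mul _
      _ ≤ _ := key
      _ = _ := by ring
  exact (ENNReal.mul_le_mul_iff_right (by simp) (by simp)).1 key2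

theorem lintegral_matchCost_le_sum (μ : Measure ℝ) [IsProbabilityMeasure μ]
    (S : Finset (Fin k)) :
    ∫⁻ z, ENNReal.ofReal (matchCost (hybrid ∅ z) (hybrid S z))
        ∂(Measure.pi fun _ => μ.prod μ) ≤
      ∑ i ∈ S, ∫⁻ z, ENNReal.ofReal (matchCost (hybrid ∅ z) (hybrid {i} z))
        ∂(Measure.pi fun _ => μ.prod μ) := by
  induction S using Finset.induction_on with
  | empty =>
    have : ∀ x : Fin k → ℝ, matchCost x x = 0 := fun x => by simp [matchCost]
    simp [this]
  | insert i S hi ih =>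
    rw [Finset.sum_insert hi]
    exact (lintegral_matchCost_insert_le μ S i hi).trans (by gcongr)

/-- The event is a product: the two values at `i` lie on opposite sides of `(u, v]`, in one of two
orders, and every other first entry avoids it. -/
theorem pi_separated_le (μ : Measure ℝ) [IsProbabilityMeasure μ] (i : Fin k) (u v : ℝ) :
    (Measure.pi fun _ : Fin k => μ.prod μ) {z | (((z i).1 ≤ u ∧ v < (z i).2) ∨
        ((z i).2 ≤ u ∧ v < (z i).1)) ∧ ∀ j, j ≠ i → (z j).1 ∉ Ioc u v} ≤
      2 * (μ (Iic u) * μ (Ioi v) * (1 - μ (Ioc u v)) ^ (k - 1)) := by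
  set B : Fin k → Set (ℝ × ℝ) := fun j =>
    if j = i then (Iic u ×ˢ Ioi v) ∪ (Ioi v ×ˢ Iic u) else (Ioc u v)ᶜ ×ˢ univ with hB
  have hset : {z : Fin k → ℝ × ℝ | (((z i).1 ≤ u ∧ v < (z i).2) ∨
        ((z i).2 ≤ u ∧ v < (z i).1)) ∧ ∀ j, j ≠ i → (z j).1 ∉ Ioc u v} = univ.pi B := by
    ext z
    simp only [mem_ofPred_eq, mem_univ_pi, hB]
    constructor
    · rintro ⟨h1, h2⟩ j
      split_ifs with hj
      · subst hj
        simp only [mem_union, mem_prod, mem_Iic, mem_Ioi]; tauto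
      · exact ⟨h2 j hj, mem_univ _⟩
    · intro h
      refine ⟨?_, fun j hj => ?_⟩
      · have := h i
        simp only [if_true, mem_union, mem_prod, mem_Iic, mem_Ioi] at this; tauto
      · have := h j
        rw [if_neg hj] at this
        exact this.1
  rw [hset, Measure.pi_pi, ← Finset.mul_prod_erase _ _ (Finset.mem_univ i)]
  have h1 : μ.prod μ (B i) ≤ 2 * (μ (Iic u) * μ (Ioi v)) := by
    simp only [hB, if_true]
    refine (measure_union_le _ _).trans_eq ?_
    rw [Measure.prod_prod, Measure.prod_prod]; ring
  have h2 : ∀ j ∈ Finset.univ.erase i, μ.prod μ (B j) = 1 - μ (Ioc u v) := by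
    intro j hj
    simp only [hB, if_neg (Finset.ne_of_mem_erase hj)]
    rw [Measure.prod_prod, measure_univ, mul_one, prob_compl_eq_one_sub measurableSet_Ioc]
  rw [Finset.prod_congr rfl h2, Finset.prod_const, Finset.card_erase_of_mem (Finset.mem_univ i),
    Finset.card_univ, Fintype.card_fin, ← mul_assoc]
  gcongr

/-- The expected matching cost of two independent samples. -/
theorem lintegral_matchCost_le (μ : Measure ℝ) [IsProbabilityMeasure μ] :
    ∫⁻ p : (Fin k → ℝ) × (Fin k → ℝ), ENNReal.ofReal (matchCost p.1 p.2)
        ∂((Measure.pi fun _ => μ).prod (Measure.pi fun _ => μ)) ≤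
      4 * k * ∫⁻ u, ∫⁻ v, if u < v then
        μ (Iic u) * μ (Ioi v) * (1 - μ (Ioc u v)) ^ (k - 1) else 0 := by
  have h1 := measurePreserving_arrowProdEquivProdArrow ℝ ℝ (Fin k) (fun _ => μ) (fun _ => μ)
  rw [← h1.lintegral_comp measurable_matchCost.ennreal_ofReal]
  have h2 := lintegral_matchCost_le_sum (k := k) μ Finset.univ
  -- The 4 is a 2 from the triangle area times a 2 from the two orders in `pi_separated_le`.
  have h3 : ∀ i ∈ (Finset.univ : Finset (Fin k)),
      ∫⁻ z, ENNReal.ofReal (matchCost (hybrid ∅ z) (hybrid {i} z))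
        ∂(Measure.pi fun _ => μ.prod μ) ≤ 4 * ∫⁻ u, ∫⁻ v, if u < v then
        μ (Iic u) * μ (Ioi v) * (1 - μ (Ioc u v)) ^ (k - 1) else 0 := by
    intro i _
    have hup : ∀ z : Fin k → ℝ × ℝ, hybrid {i} z =
        Function.update (hybrid ∅ z) i (z i).2 := by
      intro z; ext j
      by_cases hj : j = i
      · subst hj; simp [hybrid, swapOn]
      · simp [hybrid, swapOn, hj]
    have hz : ∀ z : Fin k → ℝ × ℝ, ∀ j, hybrid ∅ z j = (z j).1 := fun z j => by
      simp [hybrid, swapOn]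
    set f : (Fin k → ℝ × ℝ) → ℝ → ℝ → ENNReal := fun z u v =>
      if u < v ∧ (((z i).1 ≤ u ∧ v < (z i).2) ∨ ((z i).2 ≤ u ∧ v < (z i).1)) ∧
        ∀ j, j ≠ i → (z j).1 ∉ Ioc u v then (1 : ENNReal) else 0 with hf
    have hfm : Measurable fun q : ((Fin k → ℝ × ℝ) × ℝ) × ℝ => f q.1.1 q.1.2 q.2 := by
      refine Measurable.ite ?_ measurable_const measurable_const
      have hset : {q : ((Fin k → ℝ × ℝ) × ℝ) × ℝ | ∀ j, j ≠ i → (q.1.1 j).1 ∉ Ioc q.1.2 q.2}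
          = ⋂ j, ⋂ (_ : j ≠ i), ({q | (q.1.1 j).1 ≤ q.1.2} ∪ {q | q.2 < (q.1.1 j).1}) := by
        ext q
        simp only [mem_ofPred_eq, mem_iInter, mem_union]
        refine forall₂_congr fun j _ => ?_
        rw [mem_Ioc, not_and_or, not_lt, not_le]
      have h1 : MeasurableSet {q : ((Fin k → ℝ × ℝ) × ℝ) × ℝ | q.1.2 < q.2} :=
        measurableSet_lt (by fun_prop) (by fun_prop)
      have h2 : MeasurableSet {q : ((Fin k → ℝ × ℝ) × ℝ) × ℝ | (q.1.1 i).1 ≤ q.1.2} :=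
        measurableSet_le (by fun_prop) (by fun_prop)
      have h3 : MeasurableSet {q : ((Fin k → ℝ × ℝ) × ℝ) × ℝ | (q.1.1 i).2 ≤ q.1.2} :=
        measurableSet_le (by fun_prop) (by fun_prop)
      have h4 : MeasurableSet {q : ((Fin k → ℝ × ℝ) × ℝ) × ℝ | q.2 < (q.1.1 i).1} :=
        measurableSet_lt (by fun_prop) (by fun_prop)
      have h5 : MeasurableSet {q : ((Fin k → ℝ × ℝ) × ℝ) × ℝ | q.2 < (q.1.1 i).2} :=
        measurableSet_lt (by fun_prop) (by fun_prop)
      have h6 : MeasurableSet {q : ((Fin k → ℝ × ℝ) × ℝ) × ℝ |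
          ∀ j, j ≠ i → (q.1.1 j).1 ∉ Ioc q.1.2 q.2} := by
        rw [hset]
        exact .iInter fun j => .iInter fun _ =>
          .union (measurableSet_le (by fun_prop) (by fun_prop))
            (measurableSet_lt (by fun_prop) (by fun_prop))
      exact h1.inter (((h2.inter h5).union (h3.inter h4)).inter h6)
    calc _ ≤ ∫⁻ z, (2 * ∫⁻ u, ∫⁻ v, f z u v) ∂(Measure.pi fun _ => μ.prod μ) := by
          refine lintegral_mono fun z => ?_
          rw [hup]
          refine (ofReal_matchCost_update_le _ _ _).trans_eq ?_
          simp only [hz, hf]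
      _ = 2 * ∫⁻ u, ∫⁻ v, ∫⁻ z, f z u v ∂(Measure.pi fun _ => μ.prod μ) := by
          have hm2 : Measurable fun q : (Fin k → ℝ × ℝ) × ℝ => ∫⁻ v, f q.1 q.2 v :=
            hfm.lintegral_prod_right'
          rw [lintegral_const_mul _ hm2.lintegral_prod_right', lintegral_lintegral_swap
            hm2.aemeasurable]
          congr 1
          refine lintegral_congr fun u => ?_
          refine lintegral_lintegral_swap (Measurable.aemeasurable ?_)
          exact hfm.comp (by fun_prop : Measurable fun q : (Fin k → ℝ × ℝ) × ℝ => ((q.1, u), q.2))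
      _ ≤ 2 * ∫⁻ u, ∫⁻ v, 2 * (if u < v then
        μ (Iic u) * μ (Ioi v) * (1 - μ (Ioc u v)) ^ (k - 1) else 0) := by
          gcongr with u v
          by_cases huv : u < v
          · simp only [huv, if_true]
            refine le_trans ?_ (pi_separated_le μ i u v)
            rw [← lintegral_indicator_one₀]
            · refine lintegral_mono fun z => ?_
              simp only [hf, huv, true_and, indicator, mem_ofPred_eq, Pi.one_apply]
              exact le_rfl
            · refine MeasurableSet.nullMeasurableSet ?_
              have : Measurable fun z => f z u v := hfm.comp
                (by fun_prop : Measurable fun z : Fin k → ℝ × ℝ => ((z, u), v))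
              have h4 := this (measurableSet_singleton 1)
              convert h4 using 1
              ext z
              simp [hf, huv]
          · simp [hf, huv]
      _ = _ := by
          simp_rw [lintegral_const_mul' 2 _ (by simp : (2 : ENNReal) ≠ ⊤)]
          rw [← mul_assoc]; norm_num
  have h4 : ∀ z : Fin k → ℝ × ℝ, MeasurableEquiv.arrowProdEquivProdArrow ℝ ℝ (Fin k) z =
      (hybrid ∅ z, hybrid Finset.univ z) := by
    intro z
    ext i <;> simp [hybrid, swapOn, MeasurableEquiv.arrowProdEquivProdArrow]
  simp only [h4]
  refine h2.trans ((Finset.sum_le_sum h3).trans_eq ?_)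
  rw [Finset.sum_const, Finset.card_univ, Fintype.card_fin, nsmul_eq_mul]
  ring

end EfronStein

/-! ### The gap integral for Gaussian samples. -/

section GaussianTail

/-- The standard normal density. -/
noncomputable def stdDensity (x : ℝ) : ℝ := gaussianPDFReal 0 1 x

theorem stdDensity_eq (x : ℝ) : stdDensity x = (√(2 * Real.pi))⁻¹ * Real.exp (-x ^ 2 / 2) := by
  simp [stdDensity, gaussianPDFReal]

theorem stdDensity_pos (x : ℝ) : 0 < stdDensity x := gaussianPDFReal_pos 0 1 x one_ne_zero

theorem measurable_stdDensity : Measurable stdDensity := measurable_gaussianPDFReal 0 1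

theorem stdDensity_le_exp (x : ℝ) : stdDensity x ≤ Real.exp (-x ^ 2 / 2) := by
  rw [stdDensity_eq]
  refine mul_le_of_le_one_left (Real.exp_pos _).le (inv_le_one_of_one_le₀ ?_)
  rw [Real.one_le_sqrt]
  linarith [Real.pi_gt_three]

theorem stdDensity_le_stdDensity {x y : ℝ} (h : |x| ≤ |y|) : stdDensity y ≤ stdDensity x := by
  rw [stdDensity_eq, stdDensity_eq]
  have := sq_le_sq.2 h
  gcongr

theorem gaussianReal_eq_lintegral_stdDensity (s : Set ℝ) :
    gaussianReal 0 1 s = ∫⁻ x in s, ENNReal.ofReal (stdDensity x) :=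
  gaussianReal_apply 0 one_ne_zero s

theorem hasDerivAt_stdDensity (x : ℝ) :
    HasDerivAt (fun x => -stdDensity x) (x * stdDensity x) x := by
  have h : HasDerivAt (fun x : ℝ => -x ^ 2 / 2) (-x) x := by
    have := ((hasDerivAt_pow 2 x).neg.div_const 2)
    refine this.congr_deriv ?_
    norm_num
    ring
  have h2 := (h.exp.const_mul (√(2 * Real.pi))⁻¹).neg
  refine (h2.congr_deriv ?_).congr_of_eventuallyEq (.of_forall fun y => ?_)
  · rw [stdDensity_eq]; ring
  · simp only [Pi.neg_apply, stdDensity_eq]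

theorem tendsto_stdDensity : Tendsto stdDensity atTop (𝓝 0) := by
  have h : Tendsto (fun x : ℝ => Real.exp (-x ^ 2 / 2)) atTop (𝓝 0) := by
    refine Real.tendsto_exp_atBot.comp ?_
    simp_rw [neg_div]
    exact tendsto_neg_atTop_atBot.comp
      ((tendsto_pow_atTop two_ne_zero).atTop_div_const (by norm_num))
  exact squeeze_zero (fun x => (stdDensity_pos x).le) stdDensity_le_exp h

/-- Mills' bound for the Gaussian tail. -/
theorem gaussianReal_Ioi_le {v : ℝ} (hv : 0 < v) :
    gaussianReal 0 1 (Ioi v) ≤ ENNReal.ofReal (stdDensity v / v) := by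
  have hint : IntegrableOn (fun x => x * stdDensity x) (Ioi v) :=
    integrableOn_Ioi_deriv_of_nonneg' (fun x _ => hasDerivAt_stdDensity x)
      (fun x hx => mul_nonneg (hv.trans hx).le (stdDensity_pos x).le)
      (by simpa using tendsto_stdDensity.neg)
  have heq : ∫ x in Ioi v, x * stdDensity x = stdDensity v := by
    rw [integral_Ioi_of_hasDerivAt_of_tendsto' (fun x _ => hasDerivAt_stdDensity x) hint
      (by simpa using tendsto_stdDensity.neg :
        Tendsto (fun x => -stdDensity x) atTop (𝓝 0))]
    ring
  rw [gaussianReal_eq_lintegral_stdDensity]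
  calc _ ≤ ∫⁻ x in Ioi v, ENNReal.ofReal (v⁻¹ * (x * stdDensity x)) := by
        refine setLIntegral_mono' measurableSet_Ioi fun x hx => ENNReal.ofReal_le_ofReal ?_
        rw [← mul_assoc]
        refine le_mul_of_one_le_left (stdDensity_pos x).le ?_
        rw [← div_eq_inv_mul, one_le_div hv]
        exact (mem_Ioi.1 hx).le
    _ = _ := by
        rw [← ofReal_integral_eq_lintegral_ofReal (hint.const_mul _)
          ((ae_restrict_iff' measurableSet_Ioi).2 (.of_forall fun x hx =>
            mul_nonneg (inv_nonneg.2 hv.le)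
              (mul_nonneg (hv.trans hx).le (stdDensity_pos x).le)))]
        rw [integral_const_mul, heq, div_eq_inv_mul]

/-- The interval lies in `[-v, v]`, where the density is at least its value at `v`. -/
theorem le_gaussianReal_Ioc {u v : ℝ} (h : -v ≤ u) :
    ENNReal.ofReal (stdDensity v * (v - u)) ≤ gaussianReal 0 1 (Ioc u v) := by
  rw [gaussianReal_eq_lintegral_stdDensity, ENNReal.ofReal_mul (stdDensity_pos v).le,
    ← Real.volume_Ioc, ← setLIntegral_const]
  refine setLIntegral_mono' measurableSet_Ioc fun x hx => ENNReal.ofReal_le_ofReal ?_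
  refine stdDensity_le_stdDensity ((abs_le.2 ⟨?_, hx.2⟩).trans (le_abs_self v))
  linarith [hx.1]

theorem one_sub_gaussianReal_pow_le {u v : ℝ} (h : -v ≤ u) (huv : u ≤ v) (n : ℕ) :
    (1 - gaussianReal 0 1 (Ioc u v)) ^ n ≤
      ENNReal.ofReal (Real.exp (-(n * stdDensity v * (v - u)))) := by
  have hpos : 0 ≤ stdDensity v * (v - u) := mul_nonneg (stdDensity_pos v).le (by linarith)
  calc _ ≤ ENNReal.ofReal (Real.exp (-(stdDensity v * (v - u)))) ^ n := by
        gcongr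
        refine (tsub_le_tsub_left (le_gaussianReal_Ioc h) 1).trans ?_
        rw [← ENNReal.ofReal_one, ← ENNReal.ofReal_sub _ hpos]
        refine ENNReal.ofReal_le_ofReal ?_
        linarith [Real.add_one_le_exp (-(stdDensity v * (v - u)))]
    _ = _ := by
        rw [← ENNReal.ofReal_pow (Real.exp_pos _).le, ← Real.exp_nat_mul]
        congr 2; ring

theorem setLIntegral_exp_le {c v : ℝ} (hc : 0 < c) :
    ∫⁻ u in Ico (-v) v, ENNReal.ofReal (Real.exp (-(c * (v - u)))) ≤ ENNReal.ofReal (1 / c) := by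
  have h1 : ∀ u, Real.exp (-(c * (v - u))) = Real.exp (-(c * v)) * Real.exp (c * u) := fun u => by
    rw [← Real.exp_add]; congr 1; ring
  simp_rw [h1]
  calc _ ≤ ∫⁻ u in Iic v, ENNReal.ofReal (Real.exp (-(c * v)) * Real.exp (c * u)) :=
        lintegral_mono_set fun u hu => hu.2.le
    _ = _ := by
        rw [← ofReal_integral_eq_lintegral_ofReal ((integrableOn_exp_mul_Iic hc v).const_mul _)
          (.of_forall fun u => by positivity), integral_const_mul, integral_exp_mul_Iic hc,
          ← mul_div_assoc, ← Real.exp_add]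
        simp

/-- A cruder companion of `setLIntegral_exp_le` for the far tail, where `c`, a multiple of the
density at `v`, is too small for `1 / c` to help. -/
theorem setLIntegral_exp_le' {c v : ℝ} (hc : 0 ≤ c) :
    ∫⁻ u in Ico (-v) v, ENNReal.ofReal (Real.exp (-(c * (v - u)))) ≤ ENNReal.ofReal (2 * v) := by
  calc _ ≤ ∫⁻ u in Ico (-v) v, 1 := by
        refine setLIntegral_mono' measurableSet_Ico fun u hu => ?_
        rw [← ENNReal.ofReal_one]
        refine ENNReal.ofReal_le_ofReal (Real.exp_le_one_iff.2 ?_)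
        have := mul_nonneg hc (sub_nonneg.2 hu.2.le)
        linarith
    _ = _ := by
        rw [setLIntegral_one, Real.volume_Ico]; congr 1; ring

/-- The integrand that dominates the gap probabilities of a Gaussian sample. -/
noncomputable def gapBound (n : ℕ) (u v : ℝ) : ENNReal :=
  if -v ≤ u ∧ u < v then
    gaussianReal 0 1 (Ioi v) * ENNReal.ofReal (Real.exp (-(n * stdDensity v * (v - u)))) else 0

theorem measurable_gaussianReal_Ioi : Measurable fun v : ℝ => gaussianReal 0 1 (Ioi v) :=
  Antitone.measurable fun _ _ h => measure_mono (Ioi_subset_Ioi h)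

theorem measurable_gapBound (n : ℕ) : Measurable fun p : ℝ × ℝ => gapBound n p.1 p.2 := by
  have hm := measurable_stdDensity
  have hm2 := measurable_gaussianReal_Ioi
  have h1 : MeasurableSet {p : ℝ × ℝ | -p.2 ≤ p.1} :=
    measurableSet_le (by fun_prop) (by fun_prop)
  have h2 : MeasurableSet {p : ℝ × ℝ | p.1 < p.2} :=
    measurableSet_lt (by fun_prop) (by fun_prop)
  refine Measurable.ite (h1.inter h2) ?_ measurable_const
  exact (hm2.comp measurable_snd).mul (by fun_prop)

theorem lintegral_gapBound (n : ℕ) (v : ℝ) :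
    ∫⁻ u, gapBound n u v = gaussianReal 0 1 (Ioi v) *
      ∫⁻ u in Ico (-v) v, ENNReal.ofReal (Real.exp (-(n * stdDensity v * (v - u)))) := by
  rw [← lintegral_const_mul _ (by fun_prop), ← lintegral_indicator measurableSet_Ico]
  refine lintegral_congr fun u => ?_
  simp only [gapBound, indicator, mem_Ico]

theorem gaussianReal_neg_preimage (s : Set ℝ) (hs : MeasurableSet s) :
    gaussianReal 0 1 (Neg.neg ⁻¹' s) = gaussianReal 0 1 s := by
  have h := gaussianReal_map_neg (μ := 0) (v := 1)
  rw [neg_zero] at h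
  conv_rhs => rw [← h, Measure.map_apply measurable_neg hs]

/-- The reflection `(u, v) ↦ (-v, -u)` preserves the Gaussian law and reduces everything to `-v ≤
u`, where `v` has the larger modulus. Of the two tail factors only the one at this end is kept. -/
theorem gap_le (n : ℕ) (u v : ℝ) :
    (if u < v then gaussianReal 0 1 (Iic u) * gaussianReal 0 1 (Ioi v) *
      (1 - gaussianReal 0 1 (Ioc u v)) ^ n else 0) ≤ gapBound n u v + gapBound n (-v) (-u) := by
  have hna := nullSingletonClass_gaussianReal (μ := 0) (v := 1) one_ne_zero
  split_ifs with huv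
  swap
  · exact zero_le
  rcases le_total (-v) u with h | h
  · refine le_add_right ?_
    rw [gapBound, if_pos ⟨h, huv⟩]
    gcongr
    · exact mul_le_of_le_one_left' prob_le_one
    · exact one_sub_gaussianReal_pow_le h huv.le n
  · refine le_add_left ?_
    rw [gapBound, if_pos ⟨by linarith, by linarith⟩]
    have h1 : gaussianReal 0 1 (Ioi (-u)) = gaussianReal 0 1 (Iic u) := by
      rw [← gaussianReal_neg_preimage _ measurableSet_Ioi, measure_congr Iio_ae_eq_Iic.symm]
      congr 1; ext; simp
    have h2 : gaussianReal 0 1 (Ioc (-v) (-u)) = gaussianReal 0 1 (Ioc u v) := by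
      rw [← gaussianReal_neg_preimage _ measurableSet_Ioc, measure_congr Ico_ae_eq_Ioc.symm]
      congr 1; ext; simp
    rw [h1]
    gcongr
    · exact mul_le_of_le_one_right' prob_le_one
    · rw [← h2]
      exact one_sub_gaussianReal_pow_le (by linarith) (by linarith) n

theorem lintegral_gap_le (n : ℕ) :
    (∫⁻ u, ∫⁻ v, if u < v then gaussianReal 0 1 (Iic u) * gaussianReal 0 1 (Ioi v) *
      (1 - gaussianReal 0 1 (Ioc u v)) ^ n else 0) ≤ 2 * ∫⁻ v, ∫⁻ u, gapBound n u v := by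
  have hm := measurable_gapBound n
  have hm' : Measurable fun p : ℝ × ℝ => gapBound n (-p.2) (-p.1) :=
    hm.comp (by fun_prop : Measurable fun p : ℝ × ℝ => (-p.2, -p.1))
  calc _ ≤ ∫⁻ u, ∫⁻ v, (gapBound n u v + gapBound n (-v) (-u)) := by
        gcongr with u v; exact gap_le n u v
    _ = (∫⁻ u, ∫⁻ v, gapBound n u v) + ∫⁻ u, ∫⁻ v, gapBound n (-v) (-u) := by
        rw [← lintegral_add_left hm.lintegral_prod_right']
        refine lintegral_congr fun u => ?_
        exact lintegral_add_left (hm.comp measurable_prodMk_left) _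
    _ = _ := by
        rw [two_mul]
        congr 1
        · exact lintegral_lintegral_swap hm.aemeasurable
        · have h1 := fun f : ℝ → ENNReal => (Measure.measurePreserving_neg
            (volume : Measure ℝ)).lintegral_comp_emb (MeasurableEquiv.neg ℝ).measurableEmbedding f
          rw [h1 fun u => ∫⁻ v, gapBound n (-v) u]
          refine lintegral_congr fun u => ?_
          exact h1 fun v => gapBound n v u

/-- Three ranges of `v`. On `(0, 1]` the density is bounded below. On `(1, A]` the density in Mills'
bound cancels that in `1 / (n φ(v))`, leaving `1 / (n v)` and hence `log A / n`. Beyond `A` the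
crude length `2 v` cancels the `1 / v` of Mills' bound, leaving a Gaussian tail. -/
theorem lintegral_gapBound_le {n : ℕ} (hn : 0 < n) {A : ℝ} (hA : 1 ≤ A) :
    ∫⁻ v, ∫⁻ u, gapBound n u v ≤
      ENNReal.ofReal ((1 / stdDensity 1 + Real.log A) / n + 2 * Real.exp (-A ^ 2 / 2)) := by
  have hn' : (0 : ℝ) < n := by exact_mod_cast hn
  have hc : ∀ v, 0 < n * stdDensity v := fun v => mul_pos hn' (stdDensity_pos v)
  set F : ℝ → ENNReal := fun v => ∫⁻ u, gapBound n u v with hF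
  have h0 : ∀ v ≤ 0, F v = 0 := by
    intro v hv
    simp only [hF]
    rw [lintegral_gapBound, Ico_eq_empty (by linarith)]
    simp
  have hlog : 0 ≤ Real.log A := Real.log_nonneg hA
  have h1 : ∫⁻ v in Ioc 0 1, F v ≤ ENNReal.ofReal (1 / stdDensity 1 / n) := by
    calc _ ≤ ∫⁻ v in Ioc (0 : ℝ) 1, ENNReal.ofReal (1 / stdDensity 1 / n) := by
          refine setLIntegral_mono' measurableSet_Ioc fun v hv => ?_
          simp only [hF]
          rw [lintegral_gapBound]
          refine (mul_le_of_le_one_left' prob_le_one).trans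
            ((setLIntegral_exp_le (hc v)).trans (ENNReal.ofReal_le_ofReal ?_))
          rw [div_div, mul_comm]
          have hle : stdDensity 1 ≤ stdDensity v := stdDensity_le_stdDensity (by
            rw [abs_of_pos hv.1, abs_one]; exact hv.2)
          have := stdDensity_pos 1
          gcongr
      _ = _ := by simp
  have h2 : ∫⁻ v in Ioc 1 A, F v ≤ ENNReal.ofReal (Real.log A / n) := by
    calc _ ≤ ∫⁻ v in Ioc 1 A, ENNReal.ofReal ((n : ℝ)⁻¹ * (1 / v)) := by
          refine setLIntegral_mono' measurableSet_Ioc fun v hv => ?_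
          have hv0 : 0 < v := by linarith [hv.1]
          simp only [hF]
          rw [lintegral_gapBound]
          refine (mul_le_mul' (gaussianReal_Ioi_le hv0) (setLIntegral_exp_le (hc v))).trans ?_
          have := stdDensity_pos v
          rw [← ENNReal.ofReal_mul (by positivity)]
          refine ENNReal.ofReal_le_ofReal (le_of_eq ?_)
          field_simp
      _ = _ := by
          have hint : IntervalIntegrable (fun v : ℝ => 1 / v) volume 1 A := by
            refine intervalIntegral.intervalIntegrable_one_div (fun x hx => ?_) continuousOn_id
            rw [uIcc_of_le hA] at hx
            linarith [hx.1]
          rw [← ofReal_integral_eq_lintegral_ofReal (hint.1.const_mul _)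
            ((ae_restrict_iff' measurableSet_Ioc).2 (.of_forall fun v hv => by
              have : 0 < v := by linarith [hv.1]
              change (0 : ℝ) ≤ _
              positivity)), integral_const_mul, ← intervalIntegral.integral_of_le hA,
            integral_one_div (by rw [uIcc_of_le hA]; simp), div_one, div_eq_inv_mul]
  have h3 : ∫⁻ v in Ioi A, F v ≤ ENNReal.ofReal (2 * Real.exp (-A ^ 2 / 2)) := by
    calc _ ≤ ∫⁻ v in Ioi A, 2 * ENNReal.ofReal (stdDensity v) := by
          refine setLIntegral_mono' measurableSet_Ioi fun v hv => ?_
          have hv0 : 0 < v := by linarith [mem_Ioi.1 hv]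
          simp only [hF]
          rw [lintegral_gapBound]
          refine (mul_le_mul' (gaussianReal_Ioi_le hv0) (setLIntegral_exp_le' (hc v).le)).trans ?_
          have := stdDensity_pos v
          rw [← ENNReal.ofReal_mul (by positivity), show (2 : ENNReal) = ENNReal.ofReal 2 by simp,
            ← ENNReal.ofReal_mul (by norm_num)]
          refine ENNReal.ofReal_le_ofReal (le_of_eq ?_)
          field_simp
      _ = 2 * gaussianReal 0 1 (Ioi A) := by
          rw [lintegral_const_mul _ measurable_stdDensity.ennreal_ofReal,
            gaussianReal_eq_lintegral_stdDensity]
      _ ≤ 2 * ENNReal.ofReal (stdDensity A / A) := by gcongr; exact gaussianReal_Ioi_le (by linarith)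
      _ ≤ _ := by
          rw [show (2 : ENNReal) = ENNReal.ofReal 2 by simp, ← ENNReal.ofReal_mul (by norm_num)]
          refine ENNReal.ofReal_le_ofReal ?_
          have := (div_le_self (stdDensity_pos A).le hA).trans (stdDensity_le_exp A)
          linarith
  have hsplit : ∫⁻ v, F v ≤ (∫⁻ v in Ioc 0 1, F v) + (∫⁻ v in Ioc 1 A, F v) +
      ∫⁻ v in Ioi A, F v := by
    calc ∫⁻ v, F v = ∫⁻ v in Ioi 0, F v := by
          rw [← lintegral_indicator measurableSet_Ioi]
          refine lintegral_congr fun v => ?_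
          by_cases hv : 0 < v
          · rw [indicator_of_mem (mem_Ioi.2 hv)]
          · rw [indicator_of_notMem (notMem_Ioi.2 (not_lt.1 hv)), h0 v (by linarith)]
      _ = ∫⁻ v in (Ioc 0 1 ∪ Ioc 1 A) ∪ Ioi A, F v := by
          rw [Ioc_union_Ioc_eq_Ioc zero_le_one hA, Ioc_union_Ioi_eq_Ioi (by linarith)]
      _ ≤ _ := (lintegral_union_le _ _ _).trans (by gcongr; exact lintegral_union_le _ _ _)
  refine hsplit.trans ((add_le_add (add_le_add h1 h2) h3).trans_eq ?_)
  have := stdDensity_pos 1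
  rw [← ENNReal.ofReal_add (by positivity) (by positivity),
    ← ENNReal.ofReal_add (by positivity) (by positivity)]
  congr 1; ring

/-- Two independent standard Gaussian samples of size `k` have expected matching cost
`O(log log k)`. -/
theorem exists_lintegral_matchCost_gaussian_le :
    ∃ C : ℝ, ∀ᶠ k : ℕ in atTop,
      ∫⁻ p : (Fin k → ℝ) × (Fin k → ℝ), ENNReal.ofReal (matchCost p.1 p.2)
        ∂((Measure.pi fun _ => gaussianReal 0 1).prod (Measure.pi fun _ => gaussianReal 0 1)) ≤
      ENNReal.ofReal (C * Real.log (Real.log k)) := by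
  -- The additive constants are absorbed using `log (log k) ≥ 1`.
  refine ⟨16 / stdDensity 1 + 32, ?_⟩
  have hlog : Tendsto (fun k : ℕ => Real.log k) atTop atTop :=
    Real.tendsto_log_atTop.comp tendsto_natCast_atTop_atTop
  filter_upwards [eventually_ge_atTop 2, hlog.eventually_ge_atTop 1,
    (Real.tendsto_log_atTop.comp hlog).eventually_ge_atTop 1] with k hk hk1 hk2
  simp only [Function.comp] at hk2
  have hk0 : (2 : ℝ) ≤ k := by exact_mod_cast hk
  -- This cut-off makes the tail term `1 / k`, of the same order as the rest, while `log A` is half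
  -- of `log log k` up to a constant.
  set A := √(2 * Real.log k) with hA
  have hA1 : 1 ≤ A := by rw [hA, Real.one_le_sqrt]; linarith
  have hA2 : Real.exp (-A ^ 2 / 2) = 1 / k := by
    rw [hA, Real.sq_sqrt (by linarith), show -(2 * Real.log k) / 2 = -Real.log k by ring,
      Real.exp_neg, Real.exp_log (by linarith), one_div]
  have hA3 : Real.log A = (Real.log 2 + Real.log (Real.log k)) / 2 := by
    rw [hA, Real.log_sqrt (by linarith), Real.log_mul (by norm_num) (by linarith)]
  refine (lintegral_matchCost_le (gaussianReal 0 1)).trans ?_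
  calc _ ≤ 4 * (k : ENNReal) * (2 * ENNReal.ofReal
        ((1 / stdDensity 1 + Real.log A) / (k - 1 : ℕ) + 2 * Real.exp (-A ^ 2 / 2))) := by
        gcongr
        refine (lintegral_gap_le (k - 1)).trans ?_
        gcongr
        exact lintegral_gapBound_le (by omega) hA1
    _ = ENNReal.ofReal (8 * k * ((1 / stdDensity 1 + Real.log A) / (k - 1 : ℕ)
          + 2 * Real.exp (-A ^ 2 / 2))) := by
        rw [ENNReal.ofReal_mul (by positivity), ENNReal.ofReal_mul (by norm_num),
          ENNReal.ofReal_natCast, ENNReal.ofReal_ofNat]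
        ring
    _ ≤ _ := by
        refine ENNReal.ofReal_le_ofReal ?_
        rw [hA2, hA3, Nat.cast_sub (by omega), Nat.cast_one]
        set s := 1 / stdDensity 1 with hs
        have hs0 : 0 < s := by have := stdDensity_pos 1; positivity
        have hs1 : 16 / stdDensity 1 = 16 * s := by rw [hs]; ring
        rw [hs1]
        set l := Real.log (Real.log k)
        have hl2 := Real.log_two_lt_d9
        have hl0 : 0 < Real.log 2 := Real.log_pos (by norm_num)
        have h1 : 8 * (k : ℝ) * ((s + (Real.log 2 + l) / 2) / (k - 1) + 2 * (1 / k)) ≤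
            16 * (s + (Real.log 2 + l) / 2) + 16 := by
          have h2 : (k : ℝ) / (k - 1) ≤ 2 := by rw [div_le_iff₀ (by linarith)]; linarith
          have h3 : 8 * (k : ℝ) * ((s + (Real.log 2 + l) / 2) / (k - 1) + 2 * (1 / k)) =
            8 * ((s + (Real.log 2 + l) / 2) * (k / (k - 1))) + 16 := by
            field_simp
            ring
          rw [h3]
          have := mul_le_mul_of_nonneg_left h2 (by linarith : 0 ≤ s + (Real.log 2 + l) / 2)
          linarith
        refine h1.trans ?_
        nlinarith

end GaussianTail

/-! ### Quantiles and the comonotone transport. -/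

section Quantile

variable (μ ν : Measure ℝ)

/-- Outside `(0, 1]` the infimum is over the whole line or the empty set and takes the default value
0. These levels matter only for measurability. -/
theorem quantile_of_nonpos {p : ℝ} (hp : p ≤ 0) : quantile μ p = 0 := by
  have : {x : ℝ | p ≤ cdf μ x} = univ := eq_univ_of_forall fun x => hp.trans (cdf_nonneg μ x)
  rw [quantile, this, Real.sInf_univ]

theorem quantile_of_one_lt {p : ℝ} (hp : 1 < p) : quantile μ p = 0 := by
  have : {x : ℝ | p ≤ cdf μ x} = ∅ := eq_empty_of_forall_notMem fun x hx =>
    absurd (le_trans hx (cdf_le_one μ x)) (not_le.2 hp)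
  rw [quantile, this, Real.sInf_empty]

/-- The uniform distribution on `[0, 1]`. -/
noncomputable def uniformUnit : Measure ℝ := volume.restrict (Icc (0 : ℝ) 1)

instance : IsProbabilityMeasure uniformUnit := ⟨by simp [uniformUnit]⟩

theorem ae_mem_uniformUnit : ∀ᵐ z ∂(μ.prod uniformUnit), z.2 ∈ Icc (0 : ℝ) 1 := by
  have h : ∀ᵐ u ∂uniformUnit, u ∈ Icc (0 : ℝ) 1 := ae_restrict_mem measurableSet_Icc
  exact Measure.quasiMeasurePreserving_snd.ae h

/-- Right continuity of the distribution function makes the infimum attained. -/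
theorem quantile_le_iff {p : ℝ} (hp : p ∈ Ioo 0 1) (x : ℝ) :
    quantile μ p ≤ x ↔ p ≤ cdf μ x := by
  set S : Set ℝ := {x : ℝ | p ≤ cdf μ x} with hS
  have hne : S.Nonempty :=
    ((tendsto_cdf_atTop μ).eventually_const_le hp.2).exists
  have hbdd : BddBelow S := by
    obtain ⟨a, ha⟩ := ((tendsto_cdf_atBot μ).eventually_lt_const hp.1).exists
    refine ⟨a, fun x hx => ?_⟩
    by_contra hcon
    exact absurd (hx.trans (monotone_cdf μ (not_le.1 hcon).le)) (not_le.2 ha)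
  have hmem : sInf S ∈ S := by
    have hr : Tendsto (cdf μ) (𝓝[>] (sInf S)) (𝓝 (cdf μ (sInf S))) :=
      ((cdf μ).right_continuous (sInf S)).mono_left (nhdsWithin_mono _ Ioi_subset_Ici_self)
    refine ge_of_tendsto hr ?_
    filter_upwards [self_mem_nhdsWithin] with y hy
    obtain ⟨z, hz, hzy⟩ := exists_lt_of_csInf_lt hne hy
    exact le_trans hz (monotone_cdf μ hzy.le)
  exact ⟨fun h => hmem.trans (monotone_cdf μ h), fun h => csInf_le hbdd h⟩

theorem quantile_le_quantile {p q : ℝ} (hp : 0 < p) (hq : q < 1) (h : p ≤ q) :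
    quantile μ p ≤ quantile μ q :=
  (quantile_le_iff μ ⟨hp, h.trans_lt hq⟩ _).2
    (h.trans ((quantile_le_iff μ ⟨hp.trans_le h, hq⟩ _).1 le_rfl))

/-- The level 1 is treated as a separate point, since whether it is attained depends on `μ`. -/
theorem measurable_quantile : Measurable (quantile μ) := by
  refine measurable_of_Iic fun x => ?_
  have : quantile μ ⁻¹' Iic x = (Ioo 0 1 ∩ Iic (cdf μ x)) ∪ ((Iic 0 ∪ Ioi 1) ∩ {_p | 0 ≤ x}) ∪
      ({1} ∩ {_p | quantile μ 1 ≤ x}) := by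
    ext p
    simp only [mem_preimage, mem_Iic, mem_union, mem_inter_iff, mem_Ioi, mem_singleton_iff,
      mem_ofPred_eq]
    rcases le_or_gt p 0 with h0 | h0
    · rw [quantile_of_nonpos μ h0]
      have : ¬ p ∈ Ioo (0 : ℝ) 1 := fun h => absurd h.1 (not_lt.2 h0)
      have h2 : p ≠ 1 := by linarith
      tauto
    rcases lt_trichotomy p 1 with h1 | rfl | h1
    · rw [quantile_le_iff μ ⟨h0, h1⟩]
      have h2 : p ∈ Ioo (0 : ℝ) 1 := ⟨h0, h1⟩
      have h3 : ¬ p ≤ 0 := not_le.2 h0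
      have h4 : ¬ 1 < p := not_lt.2 h1.le
      have h5 : p ≠ 1 := h1.ne
      tauto
    · simp
    · rw [quantile_of_one_lt μ h1]
      have h2 : p ∉ Ioo (0 : ℝ) 1 := fun h => absurd h.2 (not_lt.2 h1.le)
      have h5 : p ≠ 1 := h1.ne'
      tauto
  rw [this]
  exact ((measurableSet_Ioo.inter measurableSet_Iic).union
    ((measurableSet_Iic.union measurableSet_Ioi).inter (.const _))).union
    ((measurableSet_singleton _).inter (.const _))

variable [IsProbabilityMeasure μ]

/-- The randomised distribution function of `μ`. -/
noncomputable def randomizedCDF (z : ℝ × ℝ) : ℝ := μ.real (Iio z.1) + z.2 * μ.real {z.1}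

theorem measureReal_Iio_add_singleton (x : ℝ) :
    μ.real (Iio x) + μ.real {x} = μ.real (Iic x) := by
  rw [← measureReal_union (by simp) (measurableSet_singleton x), Iio_union_right]

theorem measurable_randomizedCDF : Measurable (randomizedCDF μ) := by
  have h1 : Measurable fun x : ℝ => μ.real (Iio x) :=
    Monotone.measurable fun _ _ h => measureReal_mono (Iio_subset_Iio h)
  have h2 : Measurable fun x : ℝ => μ.real (Iic x) :=
    Monotone.measurable fun _ _ h => measureReal_mono (Iic_subset_Iic.2 h)
  have h3 : Measurable fun x : ℝ => μ.real {x} := by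
    have : (fun x : ℝ => μ.real {x}) = fun x => μ.real (Iic x) - μ.real (Iio x) := by
      ext x; rw [← measureReal_Iio_add_singleton]; ring
    rw [this]; exact h2.sub h1
  exact (h1.comp measurable_fst).add (measurable_snd.mul (h3.comp measurable_fst))

theorem measureReal_Iio_quantile_le {p : ℝ} (hp : p ∈ Ioo 0 1) :
    μ.real (Iio (quantile μ p)) ≤ p := by
  set q := quantile μ p
  have h : μ (Iio q) ≤ ENNReal.ofReal p := by
    have h1 : Iio q = ⋃ n : ℕ, Iic (q - 1 / ((n : ℝ) + 1)) := by
      ext x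
      simp only [mem_Iio, mem_iUnion, mem_Iic]
      constructor
      · intro hx
        obtain ⟨n, hn⟩ := exists_nat_one_div_lt (sub_pos.2 hx)
        exact ⟨n, by linarith⟩
      · rintro ⟨n, hn⟩
        have : (0 : ℝ) < 1 / ((n : ℝ) + 1) := by positivity
        linarith
    have hmono : Monotone fun n : ℕ => Iic (q - 1 / ((n : ℝ) + 1)) := by
      intro m n hmn
      refine Iic_subset_Iic.2 ?_
      have : (1 : ℝ) / ((n : ℝ) + 1) ≤ 1 / ((m : ℝ) + 1) := by gcongr
      linarith
    rw [h1, hmono.measure_iUnion]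
    refine iSup_le fun n => ?_
    rw [← ofReal_measureReal, ← cdf_eq_real]
    refine ENNReal.ofReal_le_ofReal (le_of_lt (not_le.1 fun hcon => ?_))
    rw [← quantile_le_iff μ hp] at hcon
    have : (0 : ℝ) < 1 / ((n : ℝ) + 1) := by positivity
    linarith
  exact ENNReal.toReal_le_of_le_ofReal hp.1.le h

theorem uniform_lt_of_mem {a m p : ℝ} (ha : a ≤ p) (hm : 0 ≤ m) (hp : p ≤ a + m) :
    m * (volume.restrict (Icc (0 : ℝ) 1)).real {u | a + u * m < p} = p - a := by
  rcases hm.eq_or_lt with rfl | hm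
  · rw [zero_mul]; linarith
  have h1 : {u : ℝ | a + u * m < p} = Iio ((p - a) / m) := by
    ext u; simp only [mem_ofPred_eq, mem_Iio, lt_div_iff₀ hm]; constructor <;> intro h <;> linarith
  have h2 : 0 ≤ (p - a) / m := div_nonneg (by linarith) hm.le
  have h3 : (p - a) / m ≤ 1 := by rw [div_le_one hm]; linarith
  rw [h1, measureReal_restrict_apply measurableSet_Iio]
  have h4 : Iio ((p - a) / m) ∩ Icc (0 : ℝ) 1 = Ico 0 ((p - a) / m) := by
    ext u; simp only [mem_inter_iff, mem_Iio, mem_Icc, mem_Ico]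
    constructor
    · rintro ⟨h, h', _⟩; exact ⟨h', h⟩
    · rintro ⟨h, h'⟩; exact ⟨h', h, by linarith⟩
  rw [h4, Real.volume_real_Ico_of_le h2]
  field_simp
  ring

theorem randomizedCDF_lt_iff {p : ℝ} (hp : p ∈ Ioo 0 1) {z : ℝ × ℝ} (hz : z.2 ∈ Icc (0 : ℝ) 1) :
    randomizedCDF μ z < p ↔ z.1 < quantile μ p ∨ (z.1 = quantile μ p ∧
      μ.real (Iio (quantile μ p)) + z.2 * μ.real {quantile μ p} < p) := by
  have h0 : 0 ≤ μ.real {z.1} := measureReal_nonneg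
  rcases lt_trichotomy z.1 (quantile μ p) with h | h | h
  · simp only [h, true_or, iff_true]
    have h1 : cdf μ z.1 < p := not_le.1 fun hc => absurd ((quantile_le_iff μ hp _).2 hc) (not_le.2 h)
    rw [cdf_eq_real, ← measureReal_Iio_add_singleton] at h1
    unfold randomizedCDF
    nlinarith [hz.2]
  · simp [randomizedCDF, h]
  · have h1 : p ≤ cdf μ (quantile μ p) := (quantile_le_iff μ hp _).1 le_rfl
    have h2 : μ.real (Iic (quantile μ p)) ≤ μ.real (Iio z.1) :=
      measureReal_mono fun x hx => lt_of_le_of_lt hx h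
    rw [cdf_eq_real] at h1
    simp only [h.not_gt, h.ne', false_or, false_and, iff_false, not_lt]
    unfold randomizedCDF
    nlinarith [hz.1, mul_nonneg hz.1 h0]

/-- The randomised distribution function is uniform: the event consists of everything below the
quantile and, at the quantile, of exactly the fraction of the atom that completes the mass to `p`.
-/
theorem prod_randomizedCDF_lt {p : ℝ} (hp : p ∈ Ioo 0 1) :
    (μ.prod uniformUnit).real {z | randomizedCDF μ z < p} = p := by
  set q := quantile μ p
  set B : Set ℝ := {u | μ.real (Iio q) + u * μ.real {q} < p} with hB
  have hBm : MeasurableSet B := measurableSet_lt (by fun_prop) (by fun_prop)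
  have h1 : ({z | randomizedCDF μ z < p} : Set (ℝ × ℝ)) =ᵐ[μ.prod uniformUnit]
      ((Iio q ×ˢ univ) ∪ ({q} ×ˢ B) : Set (ℝ × ℝ)) := by
    filter_upwards [ae_mem_uniformUnit μ] with z hz
    refine propext ?_
    change randomizedCDF μ z < p ↔ z ∈ (Iio q ×ˢ univ) ∪ ({q} ×ˢ B)
    rw [randomizedCDF_lt_iff μ hp hz]
    simp [q, B]
  rw [measureReal_congr h1, measureReal_union ?_ ((measurableSet_singleton q).prod hBm),
    measureReal_prod_prod, measureReal_prod_prod, probReal_univ, mul_one, uniformUnit,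
    uniform_lt_of_mem (measureReal_Iio_quantile_le μ hp) measureReal_nonneg]
  · ring
  · rw [measureReal_Iio_add_singleton, ← cdf_eq_real]
    exact (quantile_le_iff μ hp _).1 le_rfl
  · rw [disjoint_left]
    rintro z ⟨h, _⟩ ⟨h', _⟩
    exact absurd h' (ne_of_lt h)

/-- Keeps the argument of the quantile away from the levels with default values, so that
`quantile_le_iff` applies almost surely. -/
theorem ae_randomizedCDF_mem_Ioo : ∀ᵐ z ∂(μ.prod uniformUnit), randomizedCDF μ z ∈ Ioo (0 : ℝ) 1 := by
  have hm := measurable_randomizedCDF μ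
  have h0 : (μ.prod uniformUnit).real {z | randomizedCDF μ z ≤ 0} = 0 := by
    refine le_antisymm (le_of_forall_pos_le_add fun ε hε => ?_) measureReal_nonneg
    have hp : min ε (1 / 2) ∈ Ioo (0 : ℝ) 1 := ⟨by positivity, (min_le_right _ _).trans_lt (by norm_num)⟩
    calc _ ≤ (μ.prod uniformUnit).real {z | randomizedCDF μ z < min ε (1 / 2)} :=
          measureReal_mono fun z hz => lt_of_le_of_lt hz hp.1
      _ ≤ _ := by rw [prod_randomizedCDF_lt μ hp, zero_add]; exact min_le_left _ _
  have h1 : (μ.prod uniformUnit).real {z | 1 ≤ randomizedCDF μ z} = 0 := by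
    refine le_antisymm (le_of_forall_pos_le_add fun ε hε => ?_) measureReal_nonneg
    have hp : 1 - min ε (1 / 2) ∈ Ioo (0 : ℝ) 1 := by
      have h2 : 0 < min ε (1 / 2) := by positivity
      have h3 := min_le_right ε (1 / 2)
      constructor <;> linarith
    have h4 := probReal_compl_eq_one_sub (μ := μ.prod uniformUnit)
      (measurableSet_lt hm measurable_const : MeasurableSet
        {z | randomizedCDF μ z < 1 - min ε (1 / 2)})
    rw [prod_randomizedCDF_lt μ hp] at h4
    calc _ ≤ (μ.prod uniformUnit).real {z | randomizedCDF μ z < 1 - min ε (1 / 2)}ᶜ :=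
          measureReal_mono fun z hz => not_lt.2 (hp.2.le.trans hz)
      _ ≤ _ := by rw [h4]; have := min_le_left ε (1 / 2); linarith
  rw [measureReal_eq_zero_iff] at h0 h1
  filter_upwards [measure_eq_zero_iff_ae_notMem.1 h0, measure_eq_zero_iff_ae_notMem.1 h1] with z h h'
  exact ⟨not_le.1 h, not_le.1 h'⟩

theorem prod_randomizedCDF_le {p : ℝ} (hp : p ∈ Icc 0 1) :
    (μ.prod uniformUnit).real {z | randomizedCDF μ z ≤ p} = p := by
  have hae := ae_randomizedCDF_mem_Ioo μ
  rcases hp.2.eq_or_lt with rfl | hp1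
  · have h : ({z | randomizedCDF μ z ≤ 1} : Set (ℝ × ℝ)) =ᵐ[μ.prod uniformUnit] univ := by
      filter_upwards [hae] with z hz
      exact propext ⟨fun _ => trivial, fun _ => hz.2.le⟩
    rw [measureReal_congr h, probReal_univ]
  rcases hp.1.eq_or_lt with rfl | hp0
  · rw [measureReal_eq_zero_iff, measure_eq_zero_iff_ae_notMem]
    filter_upwards [hae] with z hz
    exact not_le.2 hz.1
  refine le_antisymm (le_of_forall_gt_imp_ge_of_dense fun q hq => ?_) ?_
  · rcases lt_or_ge q 1 with hq1 | hq1
    · rw [← prod_randomizedCDF_lt μ (p := q) ⟨hp0.trans hq, hq1⟩]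
      exact measureReal_mono fun z hz => lt_of_le_of_lt hz hq
    · exact measureReal_le_one.trans hq1
  · refine (prod_randomizedCDF_lt μ ⟨hp0, hp1⟩).symm.le.trans (measureReal_mono fun z hz => ?_)
    exact le_of_lt (mem_ofPred_eq.mp hz)

theorem measurable_comonotoneMap : Measurable fun z : ℝ × ℝ => comonotoneMap μ ν z.1 z.2 :=
  (measurable_quantile ν).comp (measurable_randomizedCDF μ)

variable [IsProbabilityMeasure ν] in
/-- The comonotone transport carries `μ` (with independent randomisation) to `ν`. -/
theorem map_comonotoneMap :
    (μ.prod uniformUnit).map (fun z => comonotoneMap μ ν z.1 z.2) = ν := by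
  have hm := measurable_comonotoneMap μ ν
  have : IsProbabilityMeasure ((μ.prod uniformUnit).map (fun z => comonotoneMap μ ν z.1 z.2)) :=
    Measure.isProbabilityMeasure_map hm.aemeasurable
  refine Measure.ext_of_Iic _ _ fun x => ?_
  rw [Measure.map_apply hm measurableSet_Iic, ← ofReal_measureReal, ← ofReal_measureReal]
  congr 1
  rw [← cdf_eq_real ν]
  conv_rhs => rw [← prod_randomizedCDF_le μ ⟨cdf_nonneg ν x, cdf_le_one ν x⟩]
  refine measureReal_congr ?_
  filter_upwards [ae_randomizedCDF_mem_Ioo μ] with z hz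
  exact propext (quantile_le_iff ν hz x)

theorem randomizedCDF_le_of_lex {z w : ℝ × ℝ} (hz : z.2 ∈ Icc (0 : ℝ) 1) (hw : w.2 ∈ Icc (0 : ℝ) 1)
    (h : z.1 < w.1 ∨ (z.1 = w.1 ∧ z.2 ≤ w.2)) : randomizedCDF μ z ≤ randomizedCDF μ w := by
  unfold randomizedCDF
  have h0 : 0 ≤ μ.real {z.1} := measureReal_nonneg
  have h1 : 0 ≤ μ.real {w.1} := measureReal_nonneg
  rcases h with h | ⟨h, h'⟩
  · have h2 : μ.real (Iic z.1) ≤ μ.real (Iio w.1) := measureReal_mono fun x hx => lt_of_le_of_lt hx h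
    rw [← measureReal_Iio_add_singleton] at h2
    nlinarith [mul_nonneg hw.1 h1, hz.2]
  · rw [h]; gcongr

end Quantile

/-! ### Laws of the increments of the two couplings. -/

/-- A centred Gaussian variable of variance zero. Hence the segment bridges do not contribute at the
grid points. -/
theorem IsBrownianBridge.ae_eq_zero_right {Ω : Type*} [MeasurableSpace Ω] {P : Measure Ω}
    [IsProbabilityMeasure P] {T : ℝ} (hT : 0 ≤ T) {b : ℝ → Ω → ℝ} (h : IsBrownianBridge T b P) :
    ∀ᵐ ω ∂P, b T ω = 0 := by
  have hmem : T ∈ Icc 0 T := ⟨hT, le_rfl⟩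
  have hg : HasGaussianLaw (b T) P := h.gaussian.hasGaussianLaw_eval ⟨T, hmem⟩
  have hvar : variance (b T) P = 0 := by
    rw [← covariance_self (h.measurable T hmem).aemeasurable, h.cov T T hT le_rfl le_rfl]
    simp
  have hlaw := hg.map_eq_gaussianReal
  rw [hvar, h.mean T hmem, Real.toNNReal_zero, gaussianReal_zero_var] at hlaw
  have : ∀ᵐ x ∂(P.map (b T)), x = 0 := by
    rw [hlaw]
    exact (ae_dirac_iff (measurableSet_singleton _)).2 rfl
  exact ae_of_ae_map (h.measurable T hmem).aemeasurable this

namespace IsCouplingInput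

variable {Ω : Type*} {k : ℕ} {X : ℝ≥0 → Ω → ℝ} {U : Ω → ℝ} {V : Fin k → Ω → ℝ} {b : ℝ → Ω → ℝ}
  {β : Fin k → ℝ → Ω → ℝ}

theorem measurable_levy (S : Set (Source k)) (hS : Source.levy ∈ S) (t : ℝ≥0) :
    Measurable[⨆ s ∈ S, Source.sigma X U V b β s] (X t) := by
  refine Measurable.mono (comap_measurable (X t)) ?_ le_rfl
  exact (le_iSup (fun t : ℝ≥0 => MeasurableSpace.comap (X t) inferInstance) t).trans
    (le_biSup (Source.sigma X U V b β) hS)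

theorem measurable_endpoint (S : Set (Source k)) (hS : Source.endpoint ∈ S) :
    Measurable[⨆ s ∈ S, Source.sigma X U V b β s] U :=
  Measurable.mono (comap_measurable U) (le_biSup (Source.sigma X U V b β) hS) le_rfl

theorem measurable_tie (S : Set (Source k)) (i : Fin k) (hS : Source.tie i ∈ S) :
    Measurable[⨆ s ∈ S, Source.sigma X U V b β s] (V i) :=
  Measurable.mono (comap_measurable (V i)) (le_biSup (Source.sigma X U V b β) hS) le_rfl

theorem measurable_bridge (S : Set (Source k)) (hS : Source.bridge ∈ S) {t : ℝ}
    (ht : t ∈ Icc (0 : ℝ) 1) :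
    Measurable[⨆ s ∈ S, Source.sigma X U V b β s] (b t) := by
  refine Measurable.mono (comap_measurable (b t)) ?_ le_rfl
  exact (le_iSup (fun t : Icc (0 : ℝ) 1 => MeasurableSpace.comap (b t) inferInstance) ⟨t, ht⟩).trans
    (le_biSup (Source.sigma X U V b β) hS)

variable [MeasurableSpace Ω] {P : Measure Ω}

theorem sigma_le (H : IsCouplingInput P k X U V b β) (s : Source k) :
    Source.sigma X U V b β s ≤ (inferInstance : MeasurableSpace Ω) := by
  cases s with
  | levy => exact iSup_le fun t => (H.levy.measurable t).comap_le
  | endpoint => exact H.measurable_U.comap_le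
  | tie i => exact (H.measurable_V i).comap_le
  | bridge => exact iSup_le fun t => (H.bridge.measurable t t.2).comap_le
  | segment i => exact iSup_le fun t => ((H.segment i).measurable t t.2).comap_le

theorem measurable_gridIncrement_levy (H : IsCouplingInput P k X U V b β) (i : Fin k) :
    Measurable (gridIncrement k X i) :=
  (H.levy.measurable _).sub (H.levy.measurable _)

/-- Functions of disjoint groups of ingredients are independent. -/
theorem indepFun_of_disjoint (H : IsCouplingInput P k X U V b β) {E F : Type*}
    [MeasurableSpace E] [MeasurableSpace F] {f : Ω → E} {g : Ω → F} {S T : Set (Source k)}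
    (hST : Disjoint S T)
    (hf : Measurable[⨆ s ∈ S, Source.sigma X U V b β s] f)
    (hg : Measurable[⨆ s ∈ T, Source.sigma X U V b β s] g) : IndepFun f g P := by
  rw [IndepFun_iff_Indep]
  exact indep_of_indep_of_le_left (indep_of_indep_of_le_right
    (indep_iSup_of_disjoint H.sigma_le H.indep hST) hg.comap_le) hf.comap_le

theorem map_tie (H : IsCouplingInput P k X U V b β) (i : Fin k) :
    P.map (V i) = uniformUnit := by
  rw [H.uniform_V i, ProbabilityTheory.cond, Real.volume_Icc]
  simp [uniformUnit]

variable [IsProbabilityMeasure P]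

theorem map_gridIncrement_levy (H : IsCouplingInput P k X U V b β) :
    P.map (fun ω i => gridIncrement k X i ω) = Measure.pi fun _ => P.map (X (1 / k)) := by
  have h1 : iIndepFun (fun i : Fin k => gridIncrement k X i) P := by
    have := H.levy.indep k (fun i => (i : ℕ) / k) fun i j hij => by
      have : ((i : ℕ) : ℝ≥0) ≤ (j : ℕ) := by exact_mod_cast hij
      exact div_le_div_of_nonneg_right this zero_le
    convert this using 2 with i
    ext ω
    simp [gridIncrement]
  rw [(iIndepFun_iff_map_fun_eq_pi_map fun i =>
    (H.measurable_gridIncrement_levy i).aemeasurable).1 h1]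
  congr 1
  ext1 i
  have h2 := (H.levy.stationary ((i : ℕ) / k) (1 / k)).map_eq
  rw [← h2]
  congr 1
  ext ω
  simp [gridIncrement, add_div]

theorem map_ties (H : IsCouplingInput P k X U V b β) :
    P.map (fun ω i => V i ω) = Measure.pi fun _ => uniformUnit := by
  have h1 : iIndepFun V P :=
    H.indep.precomp (g := Source.tie) fun i j h => by simpa using h
  rw [(iIndepFun_iff_map_fun_eq_pi_map fun i => (H.measurable_V i).aemeasurable).1 h1]
  simp_rw [H.map_tie]

theorem map_pairs (H : IsCouplingInput P k X U V b β) :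
    P.map (fun ω i => (gridIncrement k X i ω, V i ω)) =
      Measure.pi fun _ => (P.map (X (1 / k))).prod uniformUnit := by
  have : IsProbabilityMeasure (P.map (X (1 / k))) :=
    Measure.isProbabilityMeasure_map (H.levy.measurable _).aemeasurable
  have hD : Measurable fun ω i => gridIncrement k X i ω :=
    measurable_pi_lambda _ H.measurable_gridIncrement_levy
  have hV : Measurable fun ω i => V i ω := measurable_pi_lambda _ H.measurable_V
  have h1 : IndepFun (fun ω i => gridIncrement k X i ω) (fun ω i => V i ω) P := by
    refine H.indepFun_of_disjoint (S := {Source.levy}) (T := range Source.tie) ?_ ?_ ?_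
    · simp
    · exact @measurable_pi_lambda _ _ _ (_) _ _ fun i =>
        (measurable_levy _ (mem_singleton _) _).sub (measurable_levy _ (mem_singleton _) _)
    · exact @measurable_pi_lambda _ _ _ (_) _ _ fun i => measurable_tie _ i (mem_range_self i)
  have h2 := (indepFun_iff_map_prod_eq_prod_map_map hD.aemeasurable hV.aemeasurable).1 h1
  rw [H.map_gridIncrement_levy, H.map_ties] at h2
  have h3 := (measurePreserving_arrowProdEquivProdArrow ℝ ℝ (Fin k)
    (fun _ => P.map (X (1 / k))) (fun _ => uniformUnit)).symm
  rw [← h3.map_eq, ← h2, Measure.map_map h3.measurable (hD.prodMk hV)]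
  rfl

/-- The comonotonically coupled increments. -/
noncomputable def xi (P : Measure Ω) (k : ℕ) (X : ℝ≥0 → Ω → ℝ) (V : Fin k → Ω → ℝ) (ω : Ω)
    (i : Fin k) : ℝ :=
  comonotoneMap (P.map (X (1 / k))) (gaussianReal 0 (1 / k)) (gridIncrement k X i ω) (V i ω)

theorem measurable_xi (H : IsCouplingInput P k X U V b β) : Measurable (xi P k X V) := by
  have : IsProbabilityMeasure (P.map (X (1 / k))) :=
    Measure.isProbabilityMeasure_map (H.levy.measurable _).aemeasurable
  have hm := measurable_comonotoneMap (P.map (X (1 / k))) (gaussianReal 0 (1 / k))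
  refine measurable_pi_iff.2 fun i => ?_
  have h := hm.comp ((H.measurable_gridIncrement_levy i).prodMk (H.measurable_V i))
  simp only [Function.comp_def] at h
  simpa only [xi] using h

theorem map_xi (H : IsCouplingInput P k X U V b β) :
    P.map (xi P k X V) = Measure.pi fun _ => gaussianReal 0 (1 / k) := by
  have : IsProbabilityMeasure (P.map (X (1 / k))) :=
    Measure.isProbabilityMeasure_map (H.levy.measurable _).aemeasurable
  have hm := measurable_comonotoneMap (P.map (X (1 / k))) (gaussianReal 0 (1 / k))
  have hinst : ∀ _ : Fin k, SigmaFinite (((P.map (X (1 / k))).prod uniformUnit).map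
      fun z => comonotoneMap (P.map (X (1 / k))) (gaussianReal 0 (1 / k)) z.1 z.2) := fun _ => by
    rw [map_comonotoneMap]; infer_instance
  have h := Measure.pi_map_pi (ι := Fin k)
    (μ := fun _ => (P.map (X (1 / k))).prod uniformUnit)
    (f := fun _ z => comonotoneMap (P.map (X (1 / k))) (gaussianReal 0 (1 / k)) z.1 z.2)
    fun _ => hm.aemeasurable
  simp_rw [map_comonotoneMap] at h
  rw [← h, ← H.map_pairs, Measure.map_map]
  · rfl
  · exact measurable_pi_lambda _ fun i => hm.comp (measurable_pi_apply i)
  · exact measurable_pi_lambda _ fun i =>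
      (H.measurable_gridIncrement_levy i).prodMk (H.measurable_V i)

/-- Almost surely, the comonotonically coupled increments are distinct and ordered as the
increments of `X`, with ties resolved by `V`. -/
theorem ae_xi_lt_iff (H : IsCouplingInput P k X U V b β)
    (hinj : ∀ᵐ ω ∂P, Function.Injective (xi P k X V ω)) :
    ∀ᵐ ω ∂P, ∀ i j : Fin k, i ≠ j → (xi P k X V ω i < xi P k X V ω j ↔
      gridIncrement k X i ω < gridIncrement k X j ω ∨
        (gridIncrement k X i ω = gridIncrement k X j ω ∧ V i ω < V j ω)) := by
  set μ := P.map (X (1 / k)) with hμ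
  have : IsProbabilityMeasure μ :=
    Measure.isProbabilityMeasure_map (H.levy.measurable _).aemeasurable
  have hmi : ∀ i, Measurable fun ω => (gridIncrement k X i ω, V i ω) := fun i =>
    (H.measurable_gridIncrement_levy i).prodMk (H.measurable_V i)
  have hpair : ∀ i, P.map (fun ω => (gridIncrement k X i ω, V i ω)) = μ.prod uniformUnit := by
    intro i
    have h := H.map_pairs
    have h2 := (measurePreserving_eval (fun _ : Fin k => μ.prod uniformUnit) i).map_eq
    rw [← h, Measure.map_map (measurable_pi_apply i) (measurable_pi_lambda _ hmi)] at h2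
    exact h2
  have h1 : ∀ᵐ ω ∂P, ∀ i, V i ω ∈ Icc (0 : ℝ) 1 := ae_all_iff.2 fun i =>
    ae_of_ae_map (hmi i).aemeasurable (p := fun z : ℝ × ℝ => z.2 ∈ Icc (0 : ℝ) 1)
      (by rw [hpair i]; exact ae_mem_uniformUnit μ)
  have h2 : ∀ᵐ ω ∂P, ∀ i, randomizedCDF μ (gridIncrement k X i ω, V i ω) ∈ Ioo (0 : ℝ) 1 :=
    ae_all_iff.2 fun i => ae_of_ae_map (hmi i).aemeasurable
      (p := fun z : ℝ × ℝ => randomizedCDF μ z ∈ Ioo (0 : ℝ) 1)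
      (by rw [hpair i]; exact ae_randomizedCDF_mem_Ioo μ)
  filter_upwards [hinj, h1, h2] with ω hinj h1 h2 i j hij
  -- The transport is only weakly monotone for the lexicographic order; almost sure injectivity
  -- supplies strictness.
  have key : ∀ i j : Fin k, (gridIncrement k X i ω < gridIncrement k X j ω ∨
      (gridIncrement k X i ω = gridIncrement k X j ω ∧ V i ω ≤ V j ω)) →
      xi P k X V ω i ≤ xi P k X V ω j := fun i j h =>
    quantile_le_quantile _ (h2 i).1 (h2 j).2
      (randomizedCDF_le_of_lex μ (z := (gridIncrement k X i ω, V i ω))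
        (w := (gridIncrement k X j ω, V j ω)) (h1 i) (h1 j) h)
  constructor
  · intro h
    by_contra hcon
    refine absurd (key j i ?_) (not_le.2 h)
    push Not at hcon
    rcases hcon.1.lt_or_eq with h' | h'
    · exact .inl h'
    · exact .inr ⟨h', hcon.2 h'.symm⟩
  · intro h
    exact lt_of_le_of_ne (key i j (h.imp id fun h => ⟨h.1, h.2.le⟩)) (hinj.ne hij)

end IsCouplingInput

/-- Two coordinates are independent, and each section of the diagonal is a point, a null set. -/
theorem ae_injective_pi {k : ℕ} (μ : Measure ℝ) [IsProbabilityMeasure μ]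
    [NullSingletonClass μ] :
    ∀ᵐ x ∂(Measure.pi fun _ : Fin k => μ), Function.Injective x := by
  have h : ∀ i j : Fin k, i ≠ j → ∀ᵐ x ∂(Measure.pi fun _ : Fin k => μ), x i ≠ x j := by
    intro i j hij
    have hind : iIndepFun (fun (i : Fin k) (x : Fin k → ℝ) => x i) (Measure.pi fun _ => μ) := by
      rw [iIndepFun_iff_map_fun_eq_pi_map fun i => (measurable_pi_apply i).aemeasurable]
      simp_rw [(measurePreserving_eval (fun _ : Fin k => μ) _).map_eq]
      exact Measure.map_id
    have h2 := (indepFun_iff_map_prod_eq_prod_map_map (measurable_pi_apply i).aemeasurable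
      (measurable_pi_apply j).aemeasurable).1 (hind.indepFun hij)
    rw [(measurePreserving_eval (fun _ : Fin k => μ) i).map_eq,
      (measurePreserving_eval (fun _ : Fin k => μ) j).map_eq] at h2
    refine ae_of_ae_map (f := fun x : Fin k → ℝ => (x i, x j)) (p := fun z : ℝ × ℝ => z.1 ≠ z.2)
      (by fun_prop) ?_
    rw [h2, ae_iff]
    have hms : MeasurableSet {z : ℝ × ℝ | ¬ z.1 ≠ z.2} := by
      simp only [ne_eq, not_not]
      exact measurableSet_eq_fun measurable_fst measurable_snd
    rw [Measure.measure_prod_null hms]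
    refine .of_forall fun x => ?_
    have : Prod.mk x ⁻¹' {z : ℝ × ℝ | ¬ z.1 ≠ z.2} = {x} := by ext y; simp [eq_comm]
    simp only [this, measure_singleton, Pi.zero_apply]
  have h' : ∀ᵐ x ∂(Measure.pi fun _ : Fin k => μ), ∀ i j : Fin k, i ≠ j → x i ≠ x j :=
    ae_all_iff.2 fun i => ae_all_iff.2 fun j => by
      by_cases hij : i = j
      · simp [hij]
      · filter_upwards [h i j hij] with x hx _ using hx
  filter_upwards [h'] with x hx i j hij
  by_contra hne
  exact hx i j hne hij

/-- A tuple minus its mean. -/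
noncomputable def centred {k : ℕ} (x : Fin k → ℝ) (i : Fin k) : ℝ := x i - (∑ j, x j) / k

theorem measurable_centred {k : ℕ} : Measurable (centred (k := k)) := by
  unfold centred
  fun_prop

theorem grid_mem {k : ℕ} (i : Fin k) : (i : ℝ) / k ∈ Icc (0 : ℝ) 1 ∧ ((i : ℝ) + 1) / k ∈ Icc (0 : ℝ) 1 := by
  have hk : (0 : ℝ) < k := by exact_mod_cast i.pos
  have hi : (i : ℝ) + 1 ≤ k := by exact_mod_cast i.2
  refine ⟨⟨by positivity, ?_⟩, ⟨by positivity, ?_⟩⟩ <;> rw [div_le_one hk] <;> linarith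

namespace IsCouplingInput

variable {Ω : Type*} [MeasurableSpace Ω] {P : Measure Ω} {k : ℕ}
  {X : ℝ≥0 → Ω → ℝ} {U : Ω → ℝ} {V : Fin k → Ω → ℝ} {b : ℝ → Ω → ℝ} {β : Fin k → ℝ → Ω → ℝ}

theorem memLp_bridge (H : IsCouplingInput P k X U V b β) {t : ℝ} (ht : t ∈ Icc (0 : ℝ) 1) :
    MemLp (b t) 2 P :=
  (H.bridge.gaussian.hasGaussianLaw_eval ⟨t, ht⟩).memLp_two

variable [IsProbabilityMeasure P]

theorem ae_injective_xi (H : IsCouplingInput P k X U V b β) :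
    ∀ᵐ ω ∂P, Function.Injective (xi P k X V ω) := by
  rcases Nat.eq_zero_or_pos k with rfl | hk
  · exact .of_forall fun ω i => i.elim0
  have hv : (1 / k : ℝ≥0) ≠ 0 := by positivity
  have := nullSingletonClass_gaussianReal (μ := 0) hv
  refine ae_of_ae_map H.measurable_xi.aemeasurable ?_
  rw [H.map_xi]
  exact ae_injective_pi _

theorem covariance_gridIncrement_bridge (H : IsCouplingInput P k X U V b β) {i j : Fin k}
    (hij : i ≤ j) :
    covariance (gridIncrement k b i) (gridIncrement k b j) P =
      (if i = j then 1 / (k : ℝ) else 0) - 1 / (k : ℝ) ^ 2 := by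
  have hk : (0 : ℝ) < k := by exact_mod_cast i.pos
  have hi := grid_mem i
  have hj := grid_mem j
  have mi := H.memLp_bridge hi.1
  have mi' := H.memLp_bridge hi.2
  have mj := H.memLp_bridge hj.1
  have mj' := H.memLp_bridge hj.2
  have hexp : covariance (gridIncrement k b i) (gridIncrement k b j) P =
      covariance (b (((i : ℝ) + 1) / k)) (b (((j : ℝ) + 1) / k)) P
      - covariance (b (((i : ℝ) + 1) / k)) (b ((j : ℝ) / k)) P
      - (covariance (b ((i : ℝ) / k)) (b (((j : ℝ) + 1) / k)) P
      - covariance (b ((i : ℝ) / k)) (b ((j : ℝ) / k)) P) := by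
    change covariance (b (((i : ℝ) + 1) / k) - b ((i : ℝ) / k))
      (b (((j : ℝ) + 1) / k) - b ((j : ℝ) / k)) P = _
    rw [covariance_sub_left mi' mi (mj'.sub mj), covariance_sub_right mi' mj' mj,
      covariance_sub_right mi mj' mj]
  have hle : ∀ {s t : ℝ}, s ≤ t → s / k ≤ t / k := fun h => div_le_div_of_nonneg_right h hk.le
  rcases hij.eq_or_lt with rfl | hlt
  · rw [hexp, covariance_comm (b (((i : ℝ) + 1) / k)) (b ((i : ℝ) / k)),
      H.bridge.cov _ _ hi.2.1 le_rfl hi.2.2, H.bridge.cov _ _ hi.1.1 (hle (by linarith)) hi.2.2,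
      H.bridge.cov _ _ hi.1.1 le_rfl hi.1.2, if_pos rfl]
    field_simp
    ring
  · have h1 : (i : ℝ) + 1 ≤ j := by exact_mod_cast hlt
    rw [hexp, H.bridge.cov _ _ hi.2.1 (hle (by linarith)) hj.2.2,
      H.bridge.cov _ _ hi.2.1 (hle (by linarith)) hj.1.2,
      H.bridge.cov _ _ hi.1.1 (hle (by linarith)) hj.2.2,
      H.bridge.cov _ _ hi.1.1 (hle (by linarith)) hj.1.2, if_neg hlt.ne]
    field_simp
    ring

/-- The increments of a Brownian bridge, centred, are distributed as a centred Gaussian sample. -/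
theorem map_centred_gridIncrement (H : IsCouplingInput P k X U V b β) {h : ℝ → ℝ → ℝ}
    (hh : Measurable (Function.uncurry h))
    (hlaw : HasLaw (fun ω => h (X 1 ω) (U ω)) (gaussianReal 0 1) P) (hk : 0 < k) :
    P.map (fun ω => centred fun i => gridIncrement k b i ω) =
      (Measure.pi fun _ : Fin k => gaussianReal 0 (1 / k)).map centred := by
  have hk' : (0 : ℝ) < k := by exact_mod_cast hk
  have hηm : ∀ i, Measurable (gridIncrement k b i) := fun i =>
    (H.bridge.measurable _ (grid_mem i).2).sub (H.bridge.measurable _ (grid_mem i).1)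
  -- Bridge increments have covariance `δ_ij / k - 1 / k²`. A common independent term of variance `1
  -- / k²` makes them independent `N(0, 1/k)`, and centring removes it again.
  set M : Ω → ℝ := fun ω => (1 / (k : ℝ)) * h (X 1 ω) (U ω) with hM
  have hlawM : HasLaw M (gaussianReal 0 (1 / (k : ℝ≥0) ^ 2)) P := by
    have := gaussianReal_const_mul hlaw (1 / (k : ℝ))
    convert this using 2
    · simp
    · ext; simp
  have hMm : Measurable M :=
    (hh.comp ((H.levy.measurable 1).prodMk H.measurable_U)).const_mul _
  have hgM : HasGaussianLaw M P := hlawM.hasGaussianLaw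
  have hgη : HasGaussianLaw (fun ω i => gridIncrement k b i ω) P := by
    have hmem : ∀ i : Fin (k + 1), ((i : ℕ) : ℝ) / k ∈ Icc (0 : ℝ) 1 := fun i => by
      have : ((i : ℕ) : ℝ) ≤ k := by exact_mod_cast Nat.lt_succ_iff.1 i.2
      exact ⟨by positivity, by rw [div_le_one hk']; exact this⟩
    have := H.bridge.gaussian.hasGaussianLaw_increments (t := fun i : Fin (k + 1) =>
      (⟨((i : ℕ) : ℝ) / k, hmem i⟩ : Icc (0 : ℝ) 1))
    convert this using 3 with ω i
    simp [gridIncrement]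
  have hind : IndepFun (fun ω i => gridIncrement k b i ω) M P := by
    refine H.indepFun_of_disjoint (S := {Source.bridge}) (T := {Source.levy, Source.endpoint})
      (by simp) ?_ ?_
    · exact @measurable_pi_lambda _ _ _ (_) _ _ fun i =>
        (measurable_bridge _ (mem_singleton _) (grid_mem i).2).sub
          (measurable_bridge _ (mem_singleton _) (grid_mem i).1)
    · exact (hh.comp (Measurable.prodMk (measurable_levy _ (by simp) 1)
        (measurable_endpoint _ (by simp)))).const_mul _
  have hindi : ∀ i, IndepFun (gridIncrement k b i) M P := fun i =>
    hind.comp (measurable_pi_apply i) measurable_id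
  have hη2 : ∀ i, MemLp (gridIncrement k b i) 2 P := fun i =>
    (H.memLp_bridge (grid_mem i).2).sub (H.memLp_bridge (grid_mem i).1)
  have hM2 : MemLp M 2 P := hgM.memLp_two
  set ζ : Fin k → Ω → ℝ := fun i ω => gridIncrement k b i ω + M ω with hζ
  have hgζ : HasGaussianLaw (fun ω i => ζ i ω) P := by
    exact (IndepFun.hasGaussianLaw hgη hgM hind).map_fun (ContinuousLinearMap.pi fun i : Fin k =>
      (ContinuousLinearMap.proj i).comp (ContinuousLinearMap.fst ℝ (Fin k → ℝ) ℝ) +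
        ContinuousLinearMap.snd ℝ (Fin k → ℝ) ℝ)
  have hcov : ∀ i j, i ≤ j → covariance (ζ i) (ζ j) P = if i = j then 1 / (k : ℝ) else 0 := by
    intro i j hij
    have hvar : covariance M M P = 1 / (k : ℝ) ^ 2 := by
      rw [covariance_self hMm.aemeasurable, hlawM.variance_eq, variance_id_gaussianReal]
      simp
    change covariance (gridIncrement k b i + M) (gridIncrement k b j + M) P = _
    rw [covariance_add_left (hη2 i) hM2 ((hη2 j).add hM2),
      covariance_add_right (hη2 i) (hη2 j) hM2, covariance_add_right hM2 (hη2 j) hM2,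
      H.covariance_gridIncrement_bridge hij, (hindi i).covariance_eq_zero (hη2 i) hM2,
      (hindi j).symm.covariance_eq_zero hM2 (hη2 j), hvar]
    ring
  have hiind : iIndepFun ζ P := by
    refine hgζ.iIndepFun_of_covariance_eq_zero fun i j hij => ?_
    rcases le_total i j with h | h
    · rw [hcov i j h, if_neg hij]
    · rw [covariance_comm, hcov j i h, if_neg hij.symm]
  have hζm : ∀ i, Measurable (ζ i) := fun i => (hηm i).add hMm
  have hmarg : ∀ i, P.map (ζ i) = gaussianReal 0 (1 / k) := by
    intro i
    rw [(hgζ.eval i).map_eq_gaussianReal]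
    congr 1
    · have h1 : ∫ ω, gridIncrement k b i ω ∂P = 0 := by
        change ∫ ω, (b (((i : ℝ) + 1) / k) ω - b ((i : ℝ) / k) ω) ∂P = 0
        rw [integral_sub ((H.memLp_bridge (grid_mem i).2).integrable (by norm_num))
          ((H.memLp_bridge (grid_mem i).1).integrable (by norm_num)),
          H.bridge.mean _ (grid_mem i).2, H.bridge.mean _ (grid_mem i).1, sub_zero]
      have h2 : ∫ ω, M ω ∂P = 0 := by
        rw [hlawM.integral_eq, integral_id_gaussianReal]
      change ∫ ω, (gridIncrement k b i ω + M ω) ∂P = 0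
      rw [integral_add ((hη2 i).integrable (by norm_num)) (hM2.integrable (by norm_num)), h1, h2,
        add_zero]
    · rw [← covariance_self (hζm i).aemeasurable, hcov i i le_rfl, if_pos rfl]
      ext; simp
  have hmap := (iIndepFun_iff_map_fun_eq_pi_map fun i => (hζm i).aemeasurable).1 hiind
  simp_rw [hmarg] at hmap
  rw [← hmap, Measure.map_map measurable_centred (measurable_pi_lambda _ hζm)]
  congr 1
  ext ω i
  simp only [centred, Function.comp, Finset.sum_add_distrib, Finset.sum_const,
    Finset.card_univ, Fintype.card_fin, nsmul_eq_mul]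
  field_simp
  ring

/-- The comonotone increments use only `X` and the tie-breaking uniforms. The dependence of `W'` on
`X` sits entirely in the end-point term, which centring has removed. -/
theorem indepFun_xi_bridge (H : IsCouplingInput P k X U V b β) :
    IndepFun (xi P k X V) (fun ω => centred fun i => gridIncrement k b i ω) P := by
  have : IsProbabilityMeasure (P.map (X (1 / k))) :=
    Measure.isProbabilityMeasure_map (H.levy.measurable _).aemeasurable
  have hm := measurable_comonotoneMap (P.map (X (1 / k))) (gaussianReal 0 (1 / k))
  refine H.indepFun_of_disjoint (S := {Source.levy} ∪ range Source.tie) (T := {Source.bridge})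
    (by simp) ?_ ?_
  · refine @measurable_pi_lambda _ _ _ (_) _ _ fun i => ?_
    have h := hm.comp (((measurable_levy (X := X) (U := U) (V := V) (b := b) (β := β)
      ({Source.levy} ∪ range Source.tie) (by simp) (((i : ℕ) + 1) / k)).sub
      (measurable_levy _ (by simp) ((i : ℕ) / k))).prodMk (measurable_tie _ i (by simp)))
    simp only [Function.comp_def, Pi.sub_apply] at h
    simpa only [xi, gridIncrement] using h
  · exact measurable_centred.comp (@measurable_pi_lambda _ _ _ (_) _ _ fun i =>
        (measurable_bridge _ (mem_singleton _) (grid_mem i).2).sub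
          (measurable_bridge _ (mem_singleton _) (grid_mem i).1))

end IsCouplingInput

/-! ### Exchangeability of matched samples. -/

open PermutedSum

section MatchedSums

variable {k : ℕ}

theorem sum_centred (x : Fin k → ℝ) : ∑ i, centred x i = 0 := by
  rcases Nat.eq_zero_or_pos k with rfl | hk
  · simp
  have : (k : ℝ) ≠ 0 := by positivity
  simp only [centred, Finset.sum_sub_distrib, Finset.sum_const, Finset.card_univ,
    Fintype.card_fin, nsmul_eq_mul]
  field_simp
  ring

theorem centred_centred (x : Fin k → ℝ) : centred (centred x) = centred x := by
  ext i
  conv_lhs => rw [centred, sum_centred, zero_div, sub_zero]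

theorem centred_comp (x : Fin k → ℝ) (τ : Equiv.Perm (Fin k)) :
    centred (x ∘ τ) = centred x ∘ τ := by
  ext i
  simp only [centred, Function.comp, Equiv.sum_comp τ x]

theorem centred_lt_centred (x : Fin k → ℝ) (i j : Fin k) :
    centred x i < centred x j ↔ x i < x j := by
  simp [centred]

/-- Difference of the centred tuples `y ∘ σ` and `x`. -/
noncomputable def matchedDiff (σ : Equiv.Perm (Fin k)) (x y : Fin k → ℝ) (j : Fin k) : ℝ :=
  centred y (σ j) - centred x j

theorem sum_matchedDiff (σ : Equiv.Perm (Fin k)) (x y : Fin k → ℝ) :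
    ∑ j, matchedDiff σ x y j = 0 := by
  simp only [matchedDiff, Finset.sum_sub_distrib, sum_centred, Equiv.sum_comp σ (centred y),
    sub_zero]

/-- Subtracting the mean can only decrease a sum of squares. -/
theorem sum_sq_matchedDiff_le (σ : Equiv.Perm (Fin k)) (x y : Fin k → ℝ) :
    ∑ j, matchedDiff σ x y j ^ 2 ≤ ∑ j, (x j - y (σ j)) ^ 2 := by
  set c := (∑ j, y j) / k - (∑ j, x j) / k with hc
  have h : ∀ j, (x j - y (σ j)) ^ 2 =
      matchedDiff σ x y j ^ 2 + 2 * c * matchedDiff σ x y j + c ^ 2 := fun j => by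
    simp only [matchedDiff, centred, hc]; ring
  simp_rw [h, Finset.sum_add_distrib, ← Finset.mul_sum, sum_matchedDiff]
  have : 0 ≤ ∑ _j : Fin k, c ^ 2 := Finset.sum_nonneg fun _ _ => sq_nonneg _
  linarith

/-- The permutation `σ` matches the order of `y` to that of `x`. -/
def OrderMatches (σ : Equiv.Perm (Fin k)) (x y : Fin k → ℝ) : Prop :=
  ∀ i j, x i < x j ↔ y (σ i) < y (σ j)

/-- If `x` has distinct entries, a match forces the same on `y`, and two matchings sort `y`
identically. Hence the sum in `matchedMax` has at most one term, and no measurable choice of `σ` is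
needed. -/
theorem OrderMatches.unique {σ τ : Equiv.Perm (Fin k)} {x y : Fin k → ℝ}
    (hx : Function.Injective x) (hσ : OrderMatches σ x y) (hτ : OrderMatches τ x y) : σ = τ := by
  have hm : ∀ ρ : Equiv.Perm (Fin k), OrderMatches ρ x y →
      StrictMono (y ∘ (ρ * Tuple.sort x)) := by
    intro ρ hρ
    have hs : StrictMono (x ∘ Tuple.sort x) :=
      (Tuple.monotone_sort x).strictMono_of_injective (hx.comp (Tuple.sort x).injective)
    exact fun i j hij => (hρ _ _).1 (hs hij)
  have hy : Function.Injective y := by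
    have h := ((hm σ hσ).injective.comp (σ * Tuple.sort x)⁻¹.injective)
    have h2 : (y ∘ (σ * Tuple.sort x)) ∘ ((σ * Tuple.sort x)⁻¹ : Equiv.Perm (Fin k)) = y := by
      ext i; simp
    rwa [h2] at h
  have heq := Tuple.unique_monotone (hm σ hσ).monotone (hm τ hτ).monotone
  ext i
  have h3 := hy (congrFun heq ((Tuple.sort x)⁻¹ i))
  have h4 : Tuple.sort x ((Tuple.sort x)⁻¹ i) = i := by simp
  rw [Equiv.Perm.mul_apply, Equiv.Perm.mul_apply, h4] at h3
  rw [h3]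

open Classical in
/-- The maximal squared partial sum of the differences of the centred tuples, matched in order. -/
noncomputable def matchedMax (x y : Fin k → ℝ) : ENNReal :=
  ∑ σ : Equiv.Perm (Fin k), if OrderMatches σ x y then
    ENNReal.ofReal (⨆ i : Fin k, partialSum (matchedDiff σ x y) (i + 1) 1 ^ 2) else 0

theorem le_matchedMax {σ : Equiv.Perm (Fin k)} {x y : Fin k → ℝ} (h : OrderMatches σ x y) :
    ENNReal.ofReal (⨆ i : Fin k, partialSum (matchedDiff σ x y) (i + 1) 1 ^ 2) ≤
      matchedMax x y := by
  classical
  unfold matchedMax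
  refine le_trans ?_ (Finset.single_le_sum (fun _ _ => zero_le) (Finset.mem_univ σ))
  rw [if_pos h]

/-- Only the centred `y` matters, so bridge increments may be exchanged for a Gaussian sample with
the same centred law. -/
theorem matchedMax_centred (x y : Fin k → ℝ) : matchedMax x (centred y) = matchedMax x y := by
  have h : ∀ σ : Equiv.Perm (Fin k), matchedDiff σ x (centred y) = matchedDiff σ x y := fun σ => by
    ext j
    rw [matchedDiff, matchedDiff, centred_centred]
  have h2 : ∀ σ, OrderMatches σ x (centred y) ↔ OrderMatches σ x y := fun σ => by
    simp only [OrderMatches, centred_lt_centred]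
  classical exact Finset.sum_congr rfl fun σ _ => if_congr (h2 σ) (by rw [h]) rfl

theorem measurable_matchedMax :
    Measurable fun p : (Fin k → ℝ) × (Fin k → ℝ) => matchedMax p.1 p.2 := by
  classical
  unfold matchedMax
  refine Finset.measurable_sum _ fun σ _ => Measurable.ite ?_ ?_ measurable_const
  · have h : ∀ i j : Fin k, MeasurableSet {p : (Fin k → ℝ) × (Fin k → ℝ) |
        p.1 i < p.1 j ↔ p.2 (σ i) < p.2 (σ j)} := by
      intro i j
      have h1 : MeasurableSet {p : (Fin k → ℝ) × (Fin k → ℝ) | p.1 i < p.1 j} :=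
        measurableSet_lt (by fun_prop) (by fun_prop)
      have h2 : MeasurableSet {p : (Fin k → ℝ) × (Fin k → ℝ) | p.2 (σ i) < p.2 (σ j)} :=
        measurableSet_lt (by fun_prop) (by fun_prop)
      convert (h1.inter h2).union (h1.compl.inter h2.compl) using 1
      ext p
      simp only [mem_ofPred_eq, mem_union, mem_inter_iff, mem_compl_iff]
      tauto
    convert MeasurableSet.iInter fun i => MeasurableSet.iInter fun j => h i j using 1
    ext p
    simp [OrderMatches]
  · refine Measurable.ennreal_ofReal (Measurable.iSup fun i => Measurable.pow_const ?_ 2)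
    unfold partialSum matchedDiff centred
    fun_prop

/-- Substituting `σ * τ` for `σ`: permuting `x` keeps the matched differences and changes only the
order in which they are summed. -/
theorem matchedMax_comp (τ : Equiv.Perm (Fin k)) (x y : Fin k → ℝ)
    [DecidablePred fun σ => OrderMatches σ x y] :
    matchedMax (x ∘ τ) y = ∑ σ : Equiv.Perm (Fin k), if OrderMatches σ x y then
      ENNReal.ofReal (⨆ i : Fin k, partialSum (matchedDiff σ x y) (i + 1) τ ^ 2) else 0 := by
  classical
  unfold matchedMax
  rw [← Equiv.sum_comp (Equiv.mulRight τ)]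
  refine Finset.sum_congr rfl fun σ _ => ?_
  have h1 : OrderMatches (σ * τ) (x ∘ τ) y ↔ OrderMatches σ x y := by
    constructor
    · intro h i j
      have := h (τ⁻¹ i) (τ⁻¹ j)
      simpa using this
    · intro h i j
      exact h (τ i) (τ j)
  have h2 : ∀ n, partialSum (matchedDiff (σ * τ) (x ∘ τ) y) n 1 =
      partialSum (matchedDiff σ x y) n τ := fun n => by
    simp only [partialSum, matchedDiff, centred_comp, Function.comp, Equiv.Perm.mul_apply,
      Equiv.Perm.one_apply]
  simp only [Equiv.coe_mulRight, h1, h2]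

/-- For the unique matching `σ`, this is the maximal inequality in random order followed by
optimality of the monotone matching. If `y` has ties, no `σ` matches and the left side is zero. -/
theorem sum_matchedMax_comp_le {x : Fin k → ℝ} (hx : Function.Injective x) (y : Fin k → ℝ) :
    ∑ τ : Equiv.Perm (Fin k), matchedMax (x ∘ τ) y ≤
      ENNReal.ofReal (32 * (k.factorial * matchCost x y)) := by
  classical
  simp_rw [matchedMax_comp]
  rw [Finset.sum_comm]
  by_cases hex : ∃ σ, OrderMatches σ x y
  · obtain ⟨σ, hσ⟩ := hex
    rw [Finset.sum_eq_single σ]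
    · simp only [hσ, if_true]
      rw [← ENNReal.ofReal_sum_of_nonneg fun τ _ => Real.iSup_nonneg fun i => sq_nonneg _]
      refine ENNReal.ofReal_le_ofReal
        ((sum_iSup_sq_partialSum_le _ (sum_matchedDiff σ x y)).trans ?_)
      gcongr
      refine (sum_sq_matchedDiff_le σ x y).trans (sum_sq_sub_le_matchCost fun i j hij => ?_)
      exact ((hσ i j).2 hij).le
    · intro ρ _ hne
      refine Finset.sum_eq_zero fun τ _ => if_neg fun hρ => hne (hρ.unique hx hσ)
    · simp
  · refine (Finset.sum_eq_zero fun σ _ => Finset.sum_eq_zero fun τ _ =>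
      if_neg fun h => hex ⟨σ, h⟩).trans_le zero_le

theorem measurePreserving_comp_perm (μ : Measure ℝ) [IsProbabilityMeasure μ]
    (τ : Equiv.Perm (Fin k)) :
    MeasurePreserving (fun x : Fin k → ℝ => x ∘ τ) (Measure.pi fun _ => μ)
      (Measure.pi fun _ => μ) := by
  have h := measurePreserving_piCongrLeft (fun _ : Fin k => μ) τ.symm
  convert h using 1
  ext x i
  have h2 := MeasurableEquiv.piCongrLeft_apply_apply (β := fun _ : Fin k => ℝ) τ.symm x (τ i)
  simpa using h2.symm

/-- The matched partial sums of two independent samples are controlled by their matching cost. -/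
theorem lintegral_matchedMax_le (μ ν : Measure ℝ) [IsProbabilityMeasure μ]
    [NullSingletonClass μ] [IsProbabilityMeasure ν] :
    ∫⁻ p : (Fin k → ℝ) × (Fin k → ℝ), matchedMax p.1 p.2
        ∂((Measure.pi fun _ => μ).prod (Measure.pi fun _ => ν)) ≤
      32 * ∫⁻ p : (Fin k → ℝ) × (Fin k → ℝ), ENNReal.ofReal (matchCost p.1 p.2)
        ∂((Measure.pi fun _ => μ).prod (Measure.pi fun _ => ν)) := by
  set Q := (Measure.pi fun _ : Fin k => μ).prod (Measure.pi fun _ : Fin k => ν) with hQ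
  have hinv : ∀ τ : Equiv.Perm (Fin k), ∫⁻ p, matchedMax (p.1 ∘ τ) p.2 ∂Q =
      ∫⁻ p, matchedMax p.1 p.2 ∂Q := by
    intro τ
    exact ((measurePreserving_comp_perm μ τ).prod (MeasurePreserving.id _)).lintegral_comp
      measurable_matchedMax
  have hae : ∀ᵐ p ∂Q, Function.Injective p.1 :=
    Measure.quasiMeasurePreserving_fst.ae (ae_injective_pi μ)
  have hm : ∀ τ : Equiv.Perm (Fin k), Measurable fun p : (Fin k → ℝ) × (Fin k → ℝ) =>
      matchedMax (p.1 ∘ τ) p.2 := fun τ =>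
    measurable_matchedMax.comp (f := fun p : (Fin k → ℝ) × (Fin k → ℝ) => (p.1 ∘ τ, p.2))
      (((measurePreserving_comp_perm μ τ).measurable.comp measurable_fst).prodMk measurable_snd)
  have hfac : (k.factorial : ENNReal) ≠ 0 := by exact_mod_cast k.factorial_ne_zero
  -- Permuting the first sample preserves the law, so `k!` copies of the integral become a sum over
  -- all `τ`.
  refine (ENNReal.mul_le_mul_iff_right hfac (ENNReal.natCast_ne_top _)).1 ?_
  calc (k.factorial : ENNReal) * ∫⁻ p, matchedMax p.1 p.2 ∂Q
      = ∑ τ : Equiv.Perm (Fin k), ∫⁻ p, matchedMax (p.1 ∘ τ) p.2 ∂Q := by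
        simp_rw [hinv]
        simp [Fintype.card_perm]
    _ = ∫⁻ p, ∑ τ : Equiv.Perm (Fin k), matchedMax (p.1 ∘ τ) p.2 ∂Q :=
        (lintegral_finsetSum _ fun τ _ => hm τ).symm
    _ ≤ ∫⁻ p, ENNReal.ofReal (32 * (k.factorial * matchCost p.1 p.2)) ∂Q := by
        refine lintegral_mono_ae ?_
        filter_upwards [hae] with p hp using sum_matchedMax_comp_le hp p.2
    _ = _ := by
        simp_rw [ENNReal.ofReal_mul (by norm_num : (0 : ℝ) ≤ 32),
          ENNReal.ofReal_mul (Nat.cast_nonneg k.factorial), ENNReal.ofReal_natCast,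
          ENNReal.ofReal_ofNat]
        rw [lintegral_const_mul' _ _ (by simp), lintegral_const_mul' _ _ (by simp)]
        ring

/-- The optimal pairing of `x` and `y` serves as a competitor for the scaled tuples, whatever the
sign of `c`. -/
theorem matchCost_smul_le (c : ℝ) (x y : Fin k → ℝ) :
    matchCost (fun i => c * x i) (fun i => c * y i) ≤ c ^ 2 * matchCost x y := by
  refine (matchCost_le _ _ (Tuple.sort y * (Tuple.sort x)⁻¹)).trans_eq ?_
  rw [matchCost, Finset.mul_sum, ← Equiv.sum_comp (Tuple.sort x)]
  refine Finset.sum_congr rfl fun r _ => ?_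
  have h : (Tuple.sort x)⁻¹ (Tuple.sort x r) = r := by simp
  rw [Equiv.Perm.mul_apply, h]
  ring

theorem lintegral_matchCost_gaussian_scale :
    ∫⁻ p : (Fin k → ℝ) × (Fin k → ℝ), ENNReal.ofReal (matchCost p.1 p.2)
        ∂((Measure.pi fun _ => gaussianReal 0 (1 / k)).prod
          (Measure.pi fun _ => gaussianReal 0 (1 / k))) ≤
      ENNReal.ofReal (1 / k) *
      ∫⁻ p : (Fin k → ℝ) × (Fin k → ℝ), ENNReal.ofReal (matchCost p.1 p.2)
        ∂((Measure.pi fun _ => gaussianReal 0 1).prod (Measure.pi fun _ => gaussianReal 0 1)) := by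
  set c : ℝ := √(1 / k) with hc
  have hc2 : c ^ 2 = 1 / k := Real.sq_sqrt (by positivity)
  have hmap : (gaussianReal 0 1).map (fun x => c * x) = gaussianReal 0 (1 / k) := by
    rw [gaussianReal_map_const_mul]
    congr 1
    · simp
    · ext; simp [hc2]
  have hpi : MeasurePreserving (fun (x : Fin k → ℝ) i => c * x i)
      (Measure.pi fun _ => gaussianReal 0 1) (Measure.pi fun _ => gaussianReal 0 (1 / k)) :=
    measurePreserving_pi _ _ fun _ => ⟨by fun_prop, hmap⟩
  rw [← (hpi.prod hpi).lintegral_comp measurable_matchCost.ennreal_ofReal,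
    ← lintegral_const_mul' _ _ (by simp)]
  refine lintegral_mono fun p => ?_
  rw [← ENNReal.ofReal_mul (by positivity), ← hc2]
  exact ENNReal.ofReal_le_ofReal (matchCost_smul_le c p.1 p.2)

end MatchedSums

/-! ### From the couplings to two independent Gaussian samples. -/

open IsCouplingInput

theorem concat_div (k : ℕ) (p : Fin k → ℝ → ℝ) (n : ℕ) (hk : 0 < k) :
    concat k p ((n : ℝ) / k) =
      ∑ j ∈ Finset.univ.filter fun j : Fin k => (j : ℕ) < n, p j (1 / k) := by
  have hk' : (0 : ℝ) < k := by exact_mod_cast hk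
  rw [concat, Finset.sum_filter]
  refine Finset.sum_congr rfl fun j _ => ?_
  by_cases hj : (j : ℕ) < n
  · have h1 : (j : ℝ) + 1 ≤ n := by exact_mod_cast hj
    have h2 : (j : ℝ) / k < n / k := div_lt_div_of_pos_right (by linarith) hk'
    rw [if_pos h2, if_pos hj, min_eq_right]
    rw [← sub_div]
    exact div_le_div_of_nonneg_right (by linarith) hk'.le
  · have h1 : (n : ℝ) ≤ j := by exact_mod_cast not_lt.1 hj
    rw [if_neg hj, if_neg (not_lt.2 (div_le_div_of_nonneg_right h1 hk'.le))]

/-- At the grid points, the bridge of a concatenation sums the centred increments. -/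
theorem bridgeOf_concat {Ω : Type*} (k : ℕ) (p : Ω → Fin k → ℝ → ℝ) (i : Fin k) (ω : Ω) :
    bridgeOf (fun t ω => concat k (p ω) t) (((i : ℝ) + 1) / k) ω =
      partialSum (centred fun j => p ω j (1 / k)) (i + 1) 1 := by
  have hk : 0 < k := i.pos
  have hk' : (k : ℝ) ≠ 0 := by positivity
  have h1 := concat_div k (p ω) (i + 1) hk
  have h2 := concat_div k (p ω) k hk
  rw [div_self hk', Finset.filter_true_of_mem fun j _ => j.2] at h2
  push_cast at h1
  have hcard : (Finset.univ.filter fun j : Fin k => (j : ℕ) < i + 1).card = (i : ℕ) + 1 := by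
    have : (Finset.univ.filter fun j : Fin k => (j : ℕ) < i + 1) = Finset.Iic i := by
      ext j; simp only [Finset.mem_filter_univ, Finset.mem_Iic, Fin.le_def]; omega
    rw [this, Fin.card_Iic]
  simp only [bridgeOf, h1, h2, partialSum, centred, Equiv.Perm.one_apply, Finset.sum_sub_distrib,
    Finset.sum_const, hcard, nsmul_eq_mul]
  push_cast
  ring

theorem partialSum_sub {k : ℕ} (d e : Fin k → ℝ) (n : ℕ) (τ : Equiv.Perm (Fin k)) :
    partialSum (fun j => d j - e j) n τ = partialSum d n τ - partialSum e n τ :=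
  Finset.sum_sub_distrib _ _

namespace IsCouplingInput

variable {Ω : Type*} {k : ℕ} {X : ℝ≥0 → Ω → ℝ} {U : Ω → ℝ} {V : Fin k → Ω → ℝ} {b : ℝ → Ω → ℝ}
  {β : Fin k → ℝ → Ω → ℝ}

theorem gridIncrement_endpointBM (h : ℝ → ℝ → ℝ) (j : Fin k) (ω : Ω) :
    gridIncrement k (endpointBM h X U b) j ω =
      gridIncrement k b j ω + h (X 1 ω) (U ω) / k := by
  simp only [gridIncrement, endpointBM]
  ring

variable [MeasurableSpace Ω] {P : Measure Ω}

theorem measurable_gridIncrement_bridge (H : IsCouplingInput P k X U V b β) :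
    Measurable fun ω (j : Fin k) => gridIncrement k b j ω :=
  measurable_pi_lambda _ fun i =>
    (H.bridge.measurable _ (grid_mem i).2).sub (H.bridge.measurable _ (grid_mem i).1)

variable [IsProbabilityMeasure P]

/-- Segment bridges vanish at `1/k`, and the end-point term is the same for all increments, so
centring kills it. -/
theorem ae_maxSqBridgeDist_eq (H : IsCouplingInput P k X U V b β) (h : ℝ → ℝ → ℝ)
    (π : Ω → Equiv.Perm (Fin k)) :
    ∀ᵐ ω ∂P, maxSqBridgeDist k (reorderedBM k (endpointBM h X U b) π) (comonotoneBM P k X V β) ω =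
      ⨆ i : Fin k, partialSum (matchedDiff (π ω) (xi P k X V ω)
        fun j => gridIncrement k b j ω) (i + 1) 1 ^ 2 := by
  have hβ : ∀ᵐ ω ∂P, ∀ i, β i (1 / k) ω = 0 := ae_all_iff.2 fun i =>
    (H.segment i).ae_eq_zero_right (by positivity)
  filter_upwards [hβ] with ω hβ
  refine iSup_congr fun i => ?_
  have hk : (k : ℝ) ≠ 0 := by have := i.pos; positivity
  rw [sq_abs]
  congr 1
  have h1 := bridgeOf_concat k (fun ω i s => endpointBM h X U b ((π ω i : ℝ) / k + s) ω -
    endpointBM h X U b ((π ω i : ℝ) / k) ω) i ω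
  have h2 := bridgeOf_concat k (fun ω i s => β i s ω + k * s * xi P k X V ω i) i ω
  have e1 : (fun j => endpointBM h X U b ((π ω j : ℝ) / k + 1 / k) ω -
      endpointBM h X U b ((π ω j : ℝ) / k) ω) =
      (fun j => gridIncrement k b j ω + h (X 1 ω) (U ω) / k) ∘ π ω := by
    ext j
    rw [Function.comp, ← gridIncrement_endpointBM, gridIncrement, add_div]
  have e2 : (fun j => β j (1 / k) ω + k * (1 / k) * xi P k X V ω j) = xi P k X V ω := by
    ext j
    rw [hβ j]
    field_simp
    ring
  have e3 : centred (fun j => gridIncrement k b j ω + h (X 1 ω) (U ω) / k) =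
      centred fun j => gridIncrement k b j ω := by
    ext j
    simp only [centred, Finset.sum_add_distrib, Finset.sum_const, Finset.card_univ,
      Fintype.card_fin, nsmul_eq_mul]
    field_simp
    ring
  rw [e1, centred_comp, e3] at h1
  rw [e2] at h2
  change bridgeOf (fun t ω => concat k (fun i s => endpointBM h X U b ((π ω i : ℝ) / k + s) ω -
    endpointBM h X U b ((π ω i : ℝ) / k) ω) t) _ ω -
    bridgeOf (fun t ω => concat k (fun i s => β i s ω + k * s * xi P k X V ω i) t) _ ω = _
  rw [h1, h2, ← partialSum_sub]
  rfl

/-- Both orders agree with the lexicographic order of the pairs formed by increments of `X` and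
tie-breakers; the shift by the end-point term does not affect comparisons. -/
theorem ae_orderMatches (H : IsCouplingInput P k X U V b β) {h : ℝ → ℝ → ℝ}
    {π : Ω → Equiv.Perm (Fin k)}
    (hπ : IsMatchingPermutation P k X V (endpointBM h X U b) π) :
    ∀ᵐ ω ∂P, OrderMatches (π ω) (xi P k X V ω) fun j => gridIncrement k b j ω := by
  filter_upwards [H.ae_xi_lt_iff H.ae_injective_xi, hπ.order] with ω h1 h2 i j
  by_cases hij : i = j
  · simp [hij]
  · have h3 := h2 i j hij
    rw [gridIncrement_endpointBM, gridIncrement_endpointBM, add_lt_add_iff_right] at h3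
    rw [h1 i j hij, h3]

/-- Splitting over the finitely many values of `π` makes each piece an explicit function of
measurable tuples. -/
theorem measurable_iSup_matchedDiff (H : IsCouplingInput P k X U V b β)
    {π : Ω → Equiv.Perm (Fin k)} (hπ : ∀ σ, MeasurableSet {ω | π ω = σ}) :
    Measurable fun ω => ⨆ i : Fin k, partialSum (matchedDiff (π ω) (xi P k X V ω)
        fun j => gridIncrement k b j ω) (i + 1) 1 ^ 2 := by
  classical
  have h1 := H.measurable_gridIncrement_bridge
  have h2 := H.measurable_xi
  have h : ∀ σ : Equiv.Perm (Fin k), Measurable fun ω => ⨆ i : Fin k,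
      partialSum (matchedDiff σ (xi P k X V ω) fun j => gridIncrement k b j ω) (i + 1) 1 ^ 2 := by
    intro σ
    refine Measurable.iSup fun i => Measurable.pow_const ?_ 2
    refine Finset.measurable_sum _ fun j _ => ?_
    exact ((measurable_pi_apply (σ (_))).comp (measurable_centred.comp h1)).sub
      ((measurable_pi_apply _).comp (measurable_centred.comp h2))
  have hsum : (fun ω => ⨆ i : Fin k, partialSum (matchedDiff (π ω) (xi P k X V ω)
        fun j => gridIncrement k b j ω) (i + 1) 1 ^ 2) = fun ω => ∑ σ : Equiv.Perm (Fin k),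
      if π ω = σ then (⨆ i : Fin k, partialSum (matchedDiff σ (xi P k X V ω)
        fun j => gridIncrement k b j ω) (i + 1) 1 ^ 2) else 0 := by
    ext ω
    simp
  rw [hsum]
  exact Finset.measurable_sum _ fun σ _ => (h σ).ite (hπ σ) measurable_const

theorem lintegral_matchedMax_eq (H : IsCouplingInput P k X U V b β) {h : ℝ → ℝ → ℝ}
    (hh : Measurable (Function.uncurry h))
    (hlaw : HasLaw (fun ω => h (X 1 ω) (U ω)) (gaussianReal 0 1) P) (hk : 0 < k) :
    ∫⁻ ω, matchedMax (xi P k X V ω) (fun j => gridIncrement k b j ω) ∂P =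
      ∫⁻ p : (Fin k → ℝ) × (Fin k → ℝ), matchedMax p.1 p.2
        ∂((Measure.pi fun _ => gaussianReal 0 (1 / k)).prod
          (Measure.pi fun _ => gaussianReal 0 (1 / k))) := by
  have hc : Measurable fun ω => centred fun j : Fin k => gridIncrement k b j ω :=
    measurable_centred.comp H.measurable_gridIncrement_bridge
  have hx := H.measurable_xi
  have hjoint := (indepFun_iff_map_prod_eq_prod_map_map hx.aemeasurable hc.aemeasurable).1
    H.indepFun_xi_bridge
  rw [H.map_xi, H.map_centred_gridIncrement hh hlaw hk] at hjoint
  calc _ = ∫⁻ ω, matchedMax (xi P k X V ω) (centred fun j => gridIncrement k b j ω) ∂P := by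
        simp_rw [matchedMax_centred]
    _ = ∫⁻ p, matchedMax p.1 p.2 ∂(P.map fun ω =>
          (xi P k X V ω, centred fun j => gridIncrement k b j ω)) :=
        (lintegral_map measurable_matchedMax (hx.prodMk hc)).symm
    _ = _ := by
        have hmp : MeasurePreserving centred (Measure.pi fun _ : Fin k => gaussianReal 0 (1 / k))
            ((Measure.pi fun _ : Fin k => gaussianReal 0 (1 / k)).map centred) :=
          ⟨measurable_centred, rfl⟩
        have : IsProbabilityMeasure
            ((Measure.pi fun _ : Fin k => gaussianReal 0 (1 / k)).map centred) :=
          Measure.isProbabilityMeasure_map measurable_centred.aemeasurable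
        rw [hjoint, ← ((MeasurePreserving.id _).prod hmp).lintegral_comp measurable_matchedMax]
        simp only [Prod.map_fst, Prod.map_snd, id, matchedMax_centred]

end IsCouplingInput

theorem lemma2p5 :
    ∃ C : ℝ, ∀ᶠ k : ℕ in atTop,
      ∀ (Ω : Type*) [MeasurableSpace Ω] (P : Measure Ω) [IsProbabilityMeasure P]
        (X : ℝ≥0 → Ω → ℝ) (U : Ω → ℝ) (V : Fin k → Ω → ℝ) (b : ℝ → Ω → ℝ)
        (β : Fin k → ℝ → Ω → ℝ) (h : ℝ → ℝ → ℝ) (π : Ω → Equiv.Perm (Fin k)),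
        IsCouplingInput P k X U V b β →
        Measurable (Function.uncurry h) →
        HasLaw (fun ω => h (X 1 ω) (U ω)) (gaussianReal 0 1) P →
        IsMatchingPermutation P k X V (endpointBM h X U b) π →
        Integrable (maxSqBridgeDist k (reorderedBM k (endpointBM h X U b) π)
          (comonotoneBM P k X V β)) P ∧
        ∫ ω, maxSqBridgeDist k (reorderedBM k (endpointBM h X U b) π)
          (comonotoneBM P k X V β) ω ∂P ≤ C * (Real.log (Real.log k) / k) := by
  obtain ⟨C, hC⟩ := exists_lintegral_matchCost_gaussian_le
  have hlog : Tendsto (fun k : ℕ => Real.log (Real.log k)) atTop atTop :=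
    Real.tendsto_log_atTop.comp (Real.tendsto_log_atTop.comp tendsto_natCast_atTop_atTop)
  -- The factor 32 is that of the maximal inequality; `max C 0` makes the bound nonnegative, as
  -- needed to return from `ENNReal` to real integrals.
  refine ⟨32 * max C 0, ?_⟩
  filter_upwards [hC, eventually_gt_atTop 0, hlog.eventually_ge_atTop 0] with k hC hk hl
    Ω _ P _ X U V b β h π H hh hlaw hπ
  have hv : (1 / k : ℝ≥0) ≠ 0 := by positivity
  have := nullSingletonClass_gaussianReal (μ := 0) hv
  have hae := H.ae_maxSqBridgeDist_eq h π
  set D := maxSqBridgeDist k (reorderedBM k (endpointBM h X U b) π) (comonotoneBM P k X V β)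
    with hD
  have hmeas : AEStronglyMeasurable D P :=
    ((H.measurable_iSup_matchedDiff hπ.measurable).aemeasurable.congr
      (hae.mono fun ω hω => hω.symm)).aestronglyMeasurable
  have hnn : ∀ ω, 0 ≤ D ω := fun ω => Real.iSup_nonneg fun i => sq_nonneg _
  have hbound : ∫⁻ ω, ENNReal.ofReal (D ω) ∂P ≤
      ENNReal.ofReal (32 * max C 0 * (Real.log (Real.log k) / k)) := by
    calc _ ≤ ∫⁻ ω, matchedMax (xi P k X V ω) (fun j => gridIncrement k b j ω) ∂P := by
          refine lintegral_mono_ae ?_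
          filter_upwards [hae, H.ae_orderMatches hπ] with ω h1 h2
          rw [h1]
          exact le_matchedMax h2
      _ ≤ 32 * (ENNReal.ofReal (1 / k) * ENNReal.ofReal (C * Real.log (Real.log k))) := by
          rw [H.lintegral_matchedMax_eq hh hlaw hk]
          refine (lintegral_matchedMax_le _ _).trans ?_
          gcongr
          refine lintegral_matchCost_gaussian_scale.trans ?_
          gcongr
      _ ≤ 32 * (ENNReal.ofReal (1 / k) * ENNReal.ofReal (max C 0 * Real.log (Real.log k))) := by
          gcongr
          exact le_max_left _ _
      _ = _ := by
          rw [← ENNReal.ofReal_mul (by positivity), ← ENNReal.ofReal_ofNat 32,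
            ← ENNReal.ofReal_mul (by norm_num)]
          congr 1
          ring
  refine ⟨⟨hmeas, ?_⟩, ?_⟩
  · rw [hasFiniteIntegral_iff_ofReal (.of_forall hnn)]
    exact hbound.trans_lt ENNReal.ofReal_lt_top
  · rw [integral_eq_lintegral_of_nonneg_ae (.of_forall hnn) hmeas]
    exact ENNReal.toReal_le_of_le_ofReal (by positivity) hbound
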